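/- Let $(X_k)_{k\ge 0}$ be a time-homogeneous Markov chain with countable (discrete) state space $S$, transition probabilities $P=(P_{ij})_{i,j\in S}$ and an arbitrary initial distribution, and let $r:S\to\mathbb{R}^d$. Assume: 1. $P$ has a unique stationary distribution $\pi$ and the chain is uniformly geometrically ergodic: there are $K_1>0$ and $\rho\in[0,1)$ such that $\|P(X_n=\cdot\mid X_0=x)-\pi\|_{TV}\le K_1\rho^n$ for all $x\in S$ and $n\ge 0$. 2. There is a solution $V:S\to\mathbb{R}^d$ of Poisson's equation $$\bar r=r(x)+E(V(X_1)\mid X_0=x)-V(x)\qquad\text{for all } x\in S,\qquad \bar r=\sum_{y\in S}\pi_y r(y)$$ (all these expectations being assumed to exist), and there is $M_V<\infty$ such that, almost surely, $\|V(X_k)\|\le M_V$ for all $k\ge 0$. 3. With $\mathcal{F}_k=\sigma(X_0,\dots,X_k)$, $m_k=V(X_k)-E(V(X_k)\mid X_{k-1})$ and $\Sigma_k=E(m_km_k^T\mid\mathcal{F}_{k-1})$ for $k\ge 1$, one has $\lim_{n\to\infty}\frac1n(\Sigma_1+\dots+\Sigma_n)=\Sigma_\infty$ almost surely, where $$\Sigma_\infty=\sum_{i,j\in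 S}\pi_iP_{ij}\bigl(V(j)-E(V(X_1)\mid X_0=i)\bigr)\bigl(V(j)-E(V(X_1)\mid X_0=i)\bigr)^T,$$ and $\Sigma_\infty$ is positive definite. Let $$U_n=\frac1{\sqrt n}\sum_{k=1}^n\bigl(r(X_{k-1})-\bar r\bigr),\qquad Z\sim N(0,I_d),$$ and let $d_{\mathcal W}(X,Y)=\sup_h\bigl(E\,h(X)-E\,h(Y)\bigr)$, the supremum being over all functions $h:\mathbb{R}^d\to\mathbb{R}$ that are $1$-Lipschitz for the Euclidean norm. Then each $U_n$ is integrable, and for every $\beta\in(0,1)$ $$d_{\mathcal W}\bigl(U_n,\Sigma_\infty^{1/2}Z\bigr)=\mathcal{O}\bigl(n^{-\beta/2}\bigr),$$ that is, there is a constant $C$ (which may depend on the chain, $r$, $V$, $d$ and $\beta$, but not on $n$) such that $d_{\mathcal W}(U_n,\Sigma_\infty^{1/2}Z)\le C\,n^{-\beta/2}$ for all $n\ge 1$. -/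

import Mathlib

open MeasureTheory ProbabilityTheory Filter Topology
open scoped ENNReal NNReal MatrixOrder

noncomputable section

namespace MarkovCLT

/-- Euclidean space `ℝ^d` with the standard Euclidean norm. -/
abbrev Vec (d : ℕ) : Type := EuclideanSpace ℝ (Fin d)

/-- The total variation distance of two probability measures on a countable discrete space. -/
def tvDist {S : Type*} [MeasurableSpace S] (p q : Measure S) : ℝ :=
  (1 / 2) * ∑' y, |p.real {y} - q.real {y}|

/-- `π` is the unique stationary distribution of the transition kernel `P`. -/
def IsUniqueStationary {S : Type*} [MeasurableSpace S] (P : Kernel S S) (π : Measure S) : Prop :=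
  (IsProbabilityMeasure π ∧ P.Invariant π) ∧
    ∀ ν : Measure S, IsProbabilityMeasure ν → P.Invariant ν → ν = π

/-- Uniform geometric ergodicity in total variation; `P ^ n` is the `n`-step transition kernel. -/
def IsUniformlyGeometricallyErgodic {S : Type*} [MeasurableSpace S]
    (P : Kernel S S) (π : Measure S) : Prop :=
  ∃ K₁ : ℝ, 0 < K₁ ∧ ∃ ρ : ℝ, 0 ≤ ρ ∧ ρ < 1 ∧
    ∀ (x : S) (n : ℕ), tvDist ((P ^ n) x) π ≤ K₁ * ρ ^ n

/-- `X` is a time-homogeneous Markov chain, under the probability measure `μ`, with countable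
discrete state space `S`, transition probabilities `P` and an arbitrary initial distribution:
`ℙ(X₀ = x₀, …, Xₙ₊₁ = xₙ₊₁) = ℙ(X₀ = x₀, …, Xₙ = xₙ) P(xₙ, xₙ₊₁)`. -/
structure IsMarkovChain {S Ω : Type*} [MeasurableSpace S] [MeasurableSpace Ω]
    (P : Kernel S S) (μ : Measure Ω) (X : ℕ → Ω → S) : Prop where
  measurable : ∀ k, Measurable (X k)
  markov : ∀ (n : ℕ) (x : ℕ → S),
    μ {ω | ∀ k ≤ n + 1, X k ω = x k} = μ {ω | ∀ k ≤ n, X k ω = x k} * P (x n) {x (n + 1)}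

/-- `(P V)(x) = E(V(X₁) | X₀ = x)`. -/
def transitionMean {S : Type*} [MeasurableSpace S] {d : ℕ}
    (P : Kernel S S) (V : S → Vec d) (x : S) : Vec d :=
  ∫ y, V y ∂(P x)

/-- The stationary mean `r̄` of `r`. -/
def statMean {S : Type*} [MeasurableSpace S] {d : ℕ}
    (π : Measure S) (r : S → Vec d) : Vec d :=
  ∫ x, r x ∂π

/-- `V` solves Poisson's equation `r̄ = r(x) + E(V(X₁) | X₀ = x) - V(x)` for all `x`; the
expectations in the equation are required to exist. -/
structure IsPoissonSolution {S : Type*} [MeasurableSpace S] {d : ℕ}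
    (P : Kernel S S) (π : Measure S) (r V : S → Vec d) : Prop where
  integrable_reward : Integrable r π
  integrable_solution : ∀ x, Integrable V (P x)
  equation : ∀ x, statMean π r = r x + transitionMean P V x - V x

/-- The martingale differences `m_k = V(X_k) - E(V(X_k) | X_{k-1})`, for `k ≥ 1`. -/
def martDiff {S Ω : Type*} [MeasurableSpace S] {d : ℕ}
    (P : Kernel S S) (V : S → Vec d) (X : ℕ → Ω → S) (k : ℕ) (ω : Ω) : Vec d :=
  V (X k ω) - transitionMean P V (X (k - 1) ω)

/-- The `σ`-algebra `F_k` generated by `X₀, …, X_k`. -/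
abbrev pastSigma {S Ω : Type*} [MeasurableSpace S] (X : ℕ → Ω → S) (k : ℕ) : MeasurableSpace Ω :=
  ⨆ j : ℕ, ⨆ _ : j ≤ k, MeasurableSpace.comap (X j) inferInstance

/-- The `(a, b)` entry of the conditional covariance `Σ_k = E(m_k m_kᵀ | F_{k-1})`, for `k ≥ 1`. -/
def condCov {S Ω : Type*} [MeasurableSpace S] [MeasurableSpace Ω] {d : ℕ}
    (P : Kernel S S) (V : S → Vec d) (μ : Measure Ω) (X : ℕ → Ω → S) (k : ℕ) (a b : Fin d) :
    Ω → ℝ :=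
  μ[fun ω => martDiff P V X k ω a * martDiff P V X k ω b | pastSigma X (k - 1)]

/-- The asymptotic covariance
`Σ_∞ = ∑_{i,j} π_i P_{ij} (V(j) - (P V)(i)) (V(j) - (P V)(i))ᵀ`. -/
def asympCov {S : Type*} [MeasurableSpace S] {d : ℕ}
    (P : Kernel S S) (π : Measure S) (V : S → Vec d) : Matrix (Fin d) (Fin d) ℝ :=
  Matrix.of fun a b => ∑' i : S, ∑' j : S, π.real {i} * (P i).real {j} *
    ((V j - transitionMean P V i) a * (V j - transitionMean P V i) b)

/-- The covariance condition: `Σ_∞` is positive definite and, almost surely,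
`(Σ_1 + ⋯ + Σ_n) / n → Σ_∞`. -/
structure CovarianceCondition {S Ω : Type*} [MeasurableSpace S] [MeasurableSpace Ω] {d : ℕ}
    (P : Kernel S S) (π : Measure S) (V : S → Vec d) (μ : Measure Ω) (X : ℕ → Ω → S) : Prop where
  posDef : (asympCov P π V).PosDef
  tendsto : ∀ᵐ ω ∂μ, ∀ a b : Fin d,
    Tendsto (fun n : ℕ => (∑ k ∈ Finset.Icc 1 n, condCov P V μ X k a b ω) / (n : ℝ))
      atTop (𝓝 (asympCov P π V a b))

/-- `U_n = n^{-1/2} ∑_{k=1}^n (r(X_{k-1}) - r̄)`. -/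
def scaledSum {S Ω : Type*} [MeasurableSpace S] {d : ℕ}
    (π : Measure S) (r : S → Vec d) (X : ℕ → Ω → S) (n : ℕ) (ω : Ω) : Vec d :=
  (Real.sqrt n)⁻¹ • ∑ k ∈ Finset.Icc 1 n, (r (X (k - 1) ω) - statMean π r)

/-- The Wasserstein distance `sup_{h ∈ Lip_1} (E h(X) - E h(Y))` of two integrable random vectors
`X` (under `μ`) and `Y` (under `ν`), with values in `[0, ∞]`. -/
def wassersteinDist {Ω Ω' : Type*} [MeasurableSpace Ω] [MeasurableSpace Ω'] {d : ℕ}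
    (μ : Measure Ω) (X : Ω → Vec d) (ν : Measure Ω') (Y : Ω' → Vec d) : ℝ≥0∞ :=
  ⨆ (h : Vec d → ℝ) (_ : LipschitzWith 1 h),
    ENNReal.ofReal ((∫ ω, h (X ω) ∂μ) - ∫ ω, h (Y ω) ∂ν)

end MarkovCLT

end

/-!
The proof combines a martingale decomposition with Lindeberg's exchange method, where the Gaussian
that is still to be exchanged smooths the test function.

*Reduction to a martingale.* The bound on `V` holds on the states that the chain reaches with
positive probability. The chain does not leave this set and, by convergence to equilibrium, `π` is
carried by it, so `V` may be replaced by `0` elsewhere. Poisson's equation then writes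
`∑ (r (X_{k-1}) - r̄)` as a sum of bounded martingale increments plus the boundary term
`V (X_0) - V (X_n)`, which contributes `O(n^{-1/2})` after scaling. Applying `Σ_∞^{-1/2}` to `V`
makes the stationary mean of the conditional covariances of the increments the identity.

*Smoothing.* For an `L`-Lipschitz `g` let `heat s g x = 𝔼 g (x + √s Z)`. By the Cameron--Martin
theorem (`stdGaussian_map_add_right`) directional derivatives of `heat s g` are Gaussian averages of
`g` itself (`hasDerivAt_gaussSmooth`). Splitting the noise into two independent halves gives a second
derivative `heatHess s` with Lipschitz constant `O(L / s)`, hence a second-order Taylor expansion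
with remainder `O(L / s)` (`abs_heat_taylor_le`).

*Exchange.* Going from `heat (s + 1) g` at the `k`-th partial sum to `heat s g` at the next one
costs, up to `O(L / s)`, half the expected pairing of `heatHess s g` with the difference between the
conditional covariance of the increment and the identity. This pairing is not small term by term.
Uniform ergodicity provides a bounded solution `W` of Poisson's equation for the conditional
covariance (`exists_bounded_poisson_solution`), so that the pairing becomes a difference of
consecutive values of `W`, and it telescopes up to the variation of the Hessian over one step, which
is again `O(L / s)` (`abs_step_le`). Summation over `s = 1, …, n` bounds the total error by
`O(L log n)`; as `L` is proportional to `n^{-1/2}`, the distance is `O(n^{-1/2} log n)`, which is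
of smaller order than `n^{-β/2}` for every `β < 1`.
-/

namespace MarkovCLT

/-! ### Gaussian smoothing of Lipschitz functions -/

section Gaussian

variable {E : Type*} [NormedAddCommGroup E] [InnerProductSpace ℝ E] [FiniteDimensional ℝ E]
  [MeasurableSpace E] [BorelSpace E]

theorem integrable_exp_mul_norm_stdGaussian (c : ℝ) :
    Integrable (fun z : E => Real.exp (c * ‖z‖)) (stdGaussian E) := by
  obtain ⟨C, hC, hint⟩ := IsGaussian.exists_integrable_exp_sq (stdGaussian E)
  refine Integrable.mono' (hint.const_mul (Real.exp (c ^ 2 / (4 * C)))) (by fun_prop) ?_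
  filter_upwards with z
  rw [Real.norm_of_nonneg (Real.exp_pos _).le, ← Real.exp_add, Real.exp_le_exp]
  have h : c ^ 2 / (4 * C) + C * ‖z‖ ^ 2 - c * ‖z‖ = C * (‖z‖ - c / (2 * C)) ^ 2 := by
    field_simp
    ring
  nlinarith [mul_nonneg hC.le (sq_nonneg (‖z‖ - c / (2 * C)))]

theorem integrable_stdGaussian_of_exp_growth {f : E → ℝ} (hf : Continuous f) (K c : ℝ)
    (h : ∀ z, |f z| ≤ K * Real.exp (c * ‖z‖)) : Integrable f (stdGaussian E) :=
  ((integrable_exp_mul_norm_stdGaussian c).const_mul K).mono' (by fun_prop)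
    (ae_of_all _ h)

theorem integrable_norm_pow_stdGaussian (k : ℕ) :
    Integrable (fun z : E => ‖z‖ ^ k) (stdGaussian E) := by
  refine integrable_stdGaussian_of_exp_growth (by fun_prop) 1 k fun z => ?_
  rw [abs_of_nonneg (by positivity), one_mul, Real.exp_nat_mul]
  gcongr
  exact (lt_add_one _).le.trans (Real.add_one_le_exp _)

/-- Cameron--Martin theorem for the standard Gaussian: translation by `u` has density
`exp (⟪u, z⟫ - ‖u‖² / 2)`. -/
theorem stdGaussian_map_add_right (u : E) :
    (stdGaussian E).map (· + u) = (stdGaussian E).withDensity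
      (fun z => ENNReal.ofReal (Real.exp (inner ℝ u z - ‖u‖ ^ 2 / 2))) := by
  have hint : Integrable (fun z : E => Real.exp (inner ℝ u z - ‖u‖ ^ 2 / 2)) (stdGaussian E) := by
    refine integrable_stdGaussian_of_exp_growth (by fun_prop) 1 ‖u‖ fun z => ?_
    rw [abs_of_pos (Real.exp_pos _), one_mul, Real.exp_le_exp]
    nlinarith [real_inner_le_norm u z, sq_nonneg ‖u‖]
  have hfin : IsFiniteMeasure ((stdGaussian E).withDensity
      (fun z => ENNReal.ofReal (Real.exp (inner ℝ u z - ‖u‖ ^ 2 / 2)))) :=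
    isFiniteMeasure_withDensity_ofReal hint.2
  refine Measure.ext_of_charFun ?_
  ext t
  set b := stdOrthonormalBasis ℝ E with hb
  rw [charFun_apply, charFun_apply, integral_map (by fun_prop) (by fun_prop),
    integral_withDensity_eq_integral_toReal_smul (by fun_prop) (by simp)]
  simp_rw [inner_add_left, Complex.ofReal_add, add_mul, Complex.exp_add]
  rw [integral_mul_const, ← charFun_apply, charFun_stdGaussian]
  -- in an orthonormal basis the integral factorizes into complex moment generating functions
  have key : ∫ z : E, Complex.exp (∑ i, ((inner ℝ (b i) z : ℝ) : ℂ) *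
      ((inner ℝ (b i) t : ℝ) * Complex.I + (inner ℝ (b i) u : ℝ))) ∂(stdGaussian E)
      = Complex.exp (∑ i, ((inner ℝ (b i) t : ℝ) * Complex.I + (inner ℝ (b i) u : ℝ)) ^ 2 / 2) := by
    rw [stdGaussian, integral_map (Measurable.aemeasurable (by fun_prop))
      (Measurable.aestronglyMeasurable (by fun_prop))]
    have : ∀ (x : Fin (Module.finrank ℝ E) → ℝ) i, inner ℝ (b i) (∑ j, x j • b j) = x i := by
      intro x i
      rw [inner_sum]
      simp [inner_smul_right, orthonormal_iff_ite.1 b.orthonormal]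
    simp_rw [← hb, this, Complex.exp_sum]
    rw [integral_fintype_prod_eq_prod (f := fun i (x : ℝ) => Complex.exp ((x : ℂ) *
      ((inner ℝ (b i) t : ℝ) * Complex.I + (inner ℝ (b i) u : ℝ))))]
    refine Finset.prod_congr rfl fun i _ => ?_
    have := complexMGF_id_gaussianReal (μ := 0) (v := 1)
      ((inner ℝ (b i) t : ℝ) * Complex.I + (inner ℝ (b i) u : ℝ))
    rw [complexMGF] at this
    simpa [mul_comm] using this
  have e1 : ∀ x y : E, (inner ℝ x y : ℝ) = ∑ i, inner ℝ (b i) x * inner ℝ (b i) y := fun x y => by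
    rw [← b.sum_inner_mul_inner x y]
    exact Finset.sum_congr rfl fun i _ => by rw [real_inner_comm]
  have e2 : ∀ z : E, (ENNReal.ofReal (Real.exp (inner ℝ u z - ‖u‖ ^ 2 / 2))).toReal •
      Complex.exp ((inner ℝ z t : ℝ) * Complex.I) =
      Complex.exp (∑ i, ((inner ℝ (b i) z : ℝ) : ℂ) *
      ((inner ℝ (b i) t : ℝ) * Complex.I + (inner ℝ (b i) u : ℝ))) *
      Complex.exp (-(‖u‖ ^ 2 / 2 : ℝ)) := by
    intro z
    rw [ENNReal.toReal_ofReal (Real.exp_pos _).le, Complex.real_smul, Complex.ofReal_exp,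
      ← Complex.exp_add, ← Complex.exp_add, e1 u z, e1 z t]
    congr 1
    push_cast
    rw [Finset.sum_congr rfl (fun i _ => mul_add _ _ _), Finset.sum_add_distrib, Finset.sum_mul]
    simp_rw [mul_comm ((inner ℝ (b _) u : ℝ) : ℂ), mul_assoc]
    ring
  simp_rw [e2]
  rw [integral_mul_const, key, ← Complex.exp_add, ← Complex.exp_add]
  congr 1
  rw [e1 u t, ← real_inner_self_eq_norm_sq, e1 u u]
  rw [show ((‖t‖ : ℂ)) ^ 2 = ((∑ i, inner ℝ (b i) t * inner ℝ (b i) t : ℝ) : ℂ) by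
    rw [← e1, real_inner_self_eq_norm_sq]; push_cast; rfl]
  push_cast
  simp_rw [add_sq, mul_pow, Complex.I_sq]
  rw [Finset.sum_mul, ← Finset.sum_div, Finset.sum_add_distrib, Finset.sum_add_distrib]
  have h1 : ∀ i, (2 : ℂ) * ((inner ℝ (b i) t : ℝ) * Complex.I) * (inner ℝ (b i) u : ℝ) =
    2 * ((inner ℝ (b i) u : ℝ) * (inner ℝ (b i) t : ℝ) * Complex.I) := fun i => by ring
  simp_rw [h1, ← Finset.mul_sum, ← Finset.sum_mul, pow_two]
  ring

end Gaussian

theorem abs_sub_le_of_lipschitzWith {F : Type*} [SeminormedAddCommGroup F] {L : ℝ≥0} {g : F → ℝ}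
    (hg : LipschitzWith L g) (x y : F) :
    |g x - g y| ≤ L * ‖x - y‖ := by
  simpa [Real.dist_eq, dist_eq_norm] using hg.dist_le_mul x y

theorem abs_add_le_of_lipschitzWith {F : Type*} [SeminormedAddCommGroup F] {L : ℝ≥0} {g : F → ℝ}
    (hg : LipschitzWith L g) (x y : F) :
    |g (x + y)| ≤ |g x| + L * ‖y‖ := by
  have h := abs_sub_le_of_lipschitzWith hg (x + y) x
  rw [add_sub_cancel_left] at h
  have := abs_sub_abs_le_abs_sub (g (x + y)) (g x)
  linarith

theorem abs_inner_div_le {F : Type*} [SeminormedAddCommGroup F] [InnerProductSpace ℝ F]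
    (σ : ℝ≥0) (u z : F) : |inner ℝ u z / (σ : ℝ)| ≤ ‖u‖ / σ * ‖z‖ := by
  rw [abs_div, NNReal.abs_eq, div_mul_eq_mul_div]
  gcongr
  exact abs_real_inner_le_norm u z

section Smoothing

variable {E : Type*} [NormedAddCommGroup E] [InnerProductSpace ℝ E] [FiniteDimensional ℝ E]
  [MeasurableSpace E] [BorelSpace E]

/-- Gaussian smoothing of `g` at scale `σ`: `x ↦ 𝔼 g (x + σ Z)` for a standard Gaussian `Z`. -/
noncomputable def gaussSmooth (σ : ℝ≥0) (g : E → ℝ) (x : E) : ℝ :=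
  ∫ z, g (x + (σ : ℝ) • z) ∂(stdGaussian E)

/-- The integration by parts form of the derivative of `gaussSmooth σ g` in the direction `u`:
`x ↦ 𝔼 [g (x + σ Z) ⟪u, Z⟫ / σ]`. It needs no differentiability of `g`. -/
noncomputable def gaussGrad (σ : ℝ≥0) (u : E) (g : E → ℝ) (x : E) : ℝ :=
  ∫ z, g (x + (σ : ℝ) • z) * (inner ℝ u z / σ) ∂(stdGaussian E)

variable (E) in
/-- The mean norm `𝔼 ‖Z‖` of a standard Gaussian. -/
noncomputable def gaussMeanNorm : ℝ≥0 := (∫ z : E, ‖z‖ ∂(stdGaussian E)).toNNReal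

variable {L : ℝ≥0} {g : E → ℝ}

omit [BorelSpace E] in
theorem coe_gaussMeanNorm :
    (gaussMeanNorm E : ℝ) = ∫ z : E, ‖z‖ ∂(stdGaussian E) :=
  Real.coe_toNNReal _ (integral_nonneg fun _ => norm_nonneg _)

theorem integrable_norm_stdGaussian : Integrable (fun z : E => ‖z‖) (stdGaussian E) := by
  simpa using integrable_norm_pow_stdGaussian (E := E) 1

theorem integrable_comp_add_smul_stdGaussian (hg : LipschitzWith L g) (σ : ℝ) (x : E) :
    Integrable (fun z => g (x + σ • z)) (stdGaussian E) := by
  have hc := hg.continuous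
  refine ((integrable_const |g x|).add
    (integrable_norm_stdGaussian.const_mul (L * |σ|))).mono' (by fun_prop) (ae_of_all _ fun z => ?_)
  have := abs_add_le_of_lipschitzWith hg x (σ • z)
  rw [norm_smul, Real.norm_eq_abs] at this
  simp only [Pi.add_apply, Real.norm_eq_abs]
  linarith

theorem integrable_mul_inner_stdGaussian (hg : LipschitzWith L g) (σ : ℝ≥0) (u x : E) :
    Integrable (fun z => g (x + (σ : ℝ) • z) * (inner ℝ u z / σ)) (stdGaussian E) := by
  have hc := hg.continuous
  refine ((integrable_norm_stdGaussian.const_mul (|g x| * (‖u‖ / σ))).add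
    ((integrable_norm_pow_stdGaussian 2).const_mul (L * σ * (‖u‖ / σ)))).mono' (by fun_prop)
    (ae_of_all _ fun z => ?_)
  have h1 := abs_add_le_of_lipschitzWith hg x ((σ : ℝ) • z)
  rw [norm_smul, Real.norm_eq_abs, NNReal.abs_eq] at h1
  have h2 := abs_inner_div_le σ u z
  simp only [Pi.add_apply, Real.norm_eq_abs]
  rw [abs_mul]
  calc _ ≤ (|g x| + L * (σ * ‖z‖)) * (‖u‖ / σ * ‖z‖) := by gcongr
    _ = _ := by ring

theorem lipschitzWith_gaussSmooth (hg : LipschitzWith L g) (σ : ℝ≥0) :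
    LipschitzWith L (gaussSmooth σ g) := by
  refine LipschitzWith.of_dist_le_mul fun x y => ?_
  rw [Real.dist_eq, dist_eq_norm, gaussSmooth, gaussSmooth,
    ← integral_sub (integrable_comp_add_smul_stdGaussian hg _ _)
      (integrable_comp_add_smul_stdGaussian hg _ _)]
  have e : (L : ℝ) * ‖x - y‖ = L * ‖x - y‖ * (stdGaussian E).real Set.univ := by simp
  rw [e, ← Real.norm_eq_abs]
  refine norm_integral_le_of_norm_le_const (ae_of_all _ fun z => ?_)
  rw [Real.norm_eq_abs]
  simpa using abs_sub_le_of_lipschitzWith hg (x + (σ : ℝ) • z) (y + (σ : ℝ) • z)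

theorem abs_gaussSmooth_sub_le (hg : LipschitzWith L g) (σ : ℝ≥0) (x : E) :
    |gaussSmooth σ g x - g x| ≤ L * σ * gaussMeanNorm E := by
  have h : gaussSmooth σ g x - g x = ∫ z, (g (x + (σ : ℝ) • z) - g x) ∂(stdGaussian E) := by
    rw [integral_sub (integrable_comp_add_smul_stdGaussian hg _ _) (integrable_const _)]
    simp [gaussSmooth]
  rw [h, coe_gaussMeanNorm, ← integral_const_mul, ← Real.norm_eq_abs]
  refine (norm_integral_le_of_norm_le (integrable_norm_stdGaussian.const_mul _)
    (ae_of_all _ fun z => ?_))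
  have := abs_sub_le_of_lipschitzWith hg (x + (σ : ℝ) • z) x
  rw [add_sub_cancel_left, norm_smul, Real.norm_eq_abs, NNReal.abs_eq] at this
  rw [Real.norm_eq_abs]
  linarith

theorem lipschitzWith_gaussGrad (hg : LipschitzWith L g) (σ : ℝ≥0) (u : E) :
    LipschitzWith (L * (‖u‖₊ / σ * gaussMeanNorm E)) (gaussGrad σ u g) := by
  refine LipschitzWith.of_dist_le_mul fun x y => ?_
  rw [Real.dist_eq, dist_eq_norm, gaussGrad, gaussGrad,
    ← integral_sub (integrable_mul_inner_stdGaussian hg _ _ _)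
      (integrable_mul_inner_stdGaussian hg _ _ _)]
  push_cast
  rw [coe_gaussMeanNorm]
  have : (L : ℝ) * (‖u‖ / σ * ∫ z : E, ‖z‖ ∂(stdGaussian E)) * ‖x - y‖ =
    ∫ z : E, (L * ‖x - y‖ * (‖u‖ / σ)) * ‖z‖ ∂(stdGaussian E) := by
    rw [integral_const_mul]
    ring
  rw [this, ← Real.norm_eq_abs]
  refine (norm_integral_le_of_norm_le (integrable_norm_stdGaussian.const_mul _)
    (ae_of_all _ fun z => ?_))
  rw [← sub_mul, Real.norm_eq_abs, abs_mul, mul_assoc]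
  have h1 := abs_sub_le_of_lipschitzWith hg (x + (σ : ℝ) • z) (y + (σ : ℝ) • z)
  rw [add_sub_add_right_eq_sub] at h1
  exact mul_le_mul h1 (abs_inner_div_le σ u z) (abs_nonneg _) (by positivity)

/-- Smoothing turns a translation of the argument into an exponential weight. -/
theorem gaussSmooth_add_smul (σ : ℝ≥0) (hσ : σ ≠ 0) (hg : LipschitzWith L g) (u x : E) (t : ℝ) :
    gaussSmooth σ g (x + t • u) = ∫ z, g (x + (σ : ℝ) • z) *
      Real.exp (t * (inner ℝ u z / σ) - t ^ 2 * (‖u‖ ^ 2 / (2 * σ ^ 2))) ∂(stdGaussian E) := by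
  have hc := hg.continuous
  have hσ' : (σ : ℝ) ≠ 0 := by exact_mod_cast hσ
  set w : E := (t / (σ : ℝ)) • u with hw
  have h1 : gaussSmooth σ g (x + t • u) =
      ∫ y, g (x + (σ : ℝ) • y) ∂((stdGaussian E).map (· + w)) := by
    rw [integral_map (by fun_prop) (by fun_prop), gaussSmooth]
    refine integral_congr_ae (ae_of_all _ fun z => ?_)
    simp only [hw, smul_add, smul_smul, mul_div_cancel₀ _ hσ']
    congr 1
    abel
  rw [h1, stdGaussian_map_add_right, integral_withDensity_eq_integral_toReal_smul (by fun_prop)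
    (by simp)]
  refine integral_congr_ae (ae_of_all _ fun z => ?_)
  simp only [smul_eq_mul]
  rw [ENNReal.toReal_ofReal (Real.exp_pos _).le, mul_comm, hw, inner_smul_left, norm_smul]
  congr 2
  rw [Real.norm_eq_abs, mul_pow, sq_abs]
  simp only [conj_trivial]
  field_simp

/-- Gaussian integration by parts: `gaussGrad σ u g` is the derivative of `gaussSmooth σ g` in the
direction `u`, even though `g` is only Lipschitz. -/
theorem hasDerivAt_gaussSmooth (σ : ℝ≥0) (hσ : σ ≠ 0) (hg : LipschitzWith L g) (u x : E) (t : ℝ) :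
    HasDerivAt (fun s : ℝ => gaussSmooth σ g (x + s • u)) (gaussGrad σ u g (x + t • u)) t := by
  -- it suffices to differentiate at `0`: there the exponential weight is dominated uniformly
  have zero : ∀ y : E, HasDerivAt (fun s : ℝ => gaussSmooth σ g (y + s • u))
      (gaussGrad σ u g y) 0 := by
    intro y
    have hc := hg.continuous
    simp_rw [gaussSmooth_add_smul σ hσ hg]
    set b : ℝ := ‖u‖ ^ 2 / (2 * σ ^ 2) with hb
    have hb0 : 0 ≤ b := by positivity
    set c : ℝ := ‖u‖ / σ with hcc
    have hc0 : 0 ≤ c := by positivity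
    have hbd : Integrable (fun z : E => (|g y| + L * σ) * (c + 2 * b) *
        Real.exp ((2 + c) * ‖z‖)) (stdGaussian E) :=
      (integrable_exp_mul_norm_stdGaussian _).const_mul _
    have key := hasDerivAt_integral_of_dominated_loc_of_deriv_le (μ := stdGaussian E) (x₀ := (0 : ℝ))
      (F := fun s z => g (y + (σ : ℝ) • z) * Real.exp (s * (inner ℝ u z / σ) - s ^ 2 * b))
      (F' := fun s z => g (y + (σ : ℝ) • z) * (Real.exp (s * (inner ℝ u z / σ) - s ^ 2 * b) *
        ((inner ℝ u z / σ) - 2 * s * b)))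
      (Metric.ball_mem_nhds 0 one_pos) (Eventually.of_forall fun s => by fun_prop)
      (by simpa using integrable_comp_add_smul_stdGaussian hg σ y) (by fun_prop)
      (ae_of_all _ fun z s hs => ?_) hbd (ae_of_all _ fun z s _ => ?_)
    · exact key.2.congr_deriv (by simp [gaussGrad])
    · rw [mem_ball_zero_iff, Real.norm_eq_abs] at hs
      have e0 : ‖z‖ + 1 ≤ Real.exp ‖z‖ := Real.add_one_le_exp _
      have e1 : |g (y + (σ : ℝ) • z)| ≤ (|g y| + L * σ) * Real.exp ‖z‖ := by
        have := abs_add_le_of_lipschitzWith hg y ((σ : ℝ) • z)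
        rw [norm_smul, Real.norm_eq_abs, NNReal.abs_eq] at this
        calc _ ≤ (|g y| + L * σ) * (‖z‖ + 1) := by
              nlinarith [abs_nonneg (g y), norm_nonneg z,
                mul_nonneg (abs_nonneg (g y)) (norm_nonneg z),
                mul_nonneg L.coe_nonneg σ.coe_nonneg]
          _ ≤ _ := by gcongr
      have h2 : |inner ℝ u z / (σ : ℝ)| ≤ c * ‖z‖ := abs_inner_div_le σ u z
      have e2 : |inner ℝ u z / (σ : ℝ) - 2 * s * b| ≤ (c + 2 * b) * Real.exp ‖z‖ := by
        have h3 : |2 * s * b| ≤ 2 * b := by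
          rw [abs_mul, abs_mul, abs_of_nonneg hb0, abs_two]
          nlinarith
        calc _ ≤ |inner ℝ u z / (σ : ℝ)| + |2 * s * b| := abs_sub _ _
          _ ≤ (c + 2 * b) * (‖z‖ + 1) := by
              nlinarith [norm_nonneg z, mul_nonneg hb0 (norm_nonneg z)]
          _ ≤ _ := by gcongr
      have e3 : Real.exp (s * (inner ℝ u z / σ) - s ^ 2 * b) ≤ Real.exp (c * ‖z‖) := by
        rw [Real.exp_le_exp]
        have : s * (inner ℝ u z / (σ : ℝ)) ≤ 1 * (c * ‖z‖) :=
          (le_abs_self _).trans (by rw [abs_mul]; gcongr)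
        nlinarith [mul_nonneg (sq_nonneg s) hb0]
      rw [Real.norm_eq_abs, abs_mul, abs_mul, Real.abs_exp]
      calc _ ≤ ((|g y| + L * σ) * Real.exp ‖z‖) * (Real.exp (c * ‖z‖) *
            ((c + 2 * b) * Real.exp ‖z‖)) := by gcongr
        _ = _ := by
          rw [show (2 + c) * ‖z‖ = ‖z‖ + c * ‖z‖ + ‖z‖ by ring, Real.exp_add, Real.exp_add]
          ring
    · refine HasDerivAt.const_mul _ (HasDerivAt.exp ?_)
      have h1 := (hasDerivAt_id s).mul_const (inner ℝ u z / (σ : ℝ))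
      have h2 := ((hasDerivAt_id s).pow 2).mul_const b
      exact (h1.sub h2).congr_deriv (by simp)
  have h0 := zero (x + t • u)
  rw [← sub_self t] at h0
  refine (h0.comp_sub_const t t).congr_of_eventuallyEq (Eventually.of_forall fun s => ?_)
  simp only
  congr 1
  module

theorem abs_gaussGrad_le (σ : ℝ≥0) (hσ : σ ≠ 0) (hg : LipschitzWith L g) (u x : E) :
    |gaussGrad σ u g x| ≤ L * ‖u‖ := by
  have h := hasDerivAt_gaussSmooth σ hσ hg u x 0
  rw [zero_smul, add_zero] at h
  refine h.le_of_lip' (by positivity) (Eventually.of_forall fun s => ?_)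
  have := abs_sub_le_of_lipschitzWith (lipschitzWith_gaussSmooth hg σ) (x + s • u) (x + (0 : ℝ) • u)
  rw [Real.norm_eq_abs, sub_zero]
  refine this.trans (le_of_eq ?_)
  simp [norm_smul]
  ring

theorem map_prod_stdGaussian (σ τ ρ : ℝ) (h : σ ^ 2 + τ ^ 2 = ρ ^ 2) :
    ((stdGaussian E).prod (stdGaussian E)).map (fun p => σ • p.1 + τ • p.2) =
      (stdGaussian E).map (fun z => ρ • z) := by
  have hf1 : IsProbabilityMeasure (((stdGaussian E).prod (stdGaussian E)).map
      (fun p => σ • p.1 + τ • p.2)) := Measure.isProbabilityMeasure_map (by fun_prop)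
  have hf2 : IsProbabilityMeasure ((stdGaussian E).map (fun z => ρ • z)) :=
    Measure.isProbabilityMeasure_map (by fun_prop)
  refine Measure.ext_of_charFun ?_
  ext t
  have hs : ∀ c : ℝ, ∫ z : E, Complex.exp ((inner ℝ (c • z) t : ℝ) * Complex.I) ∂(stdGaussian E)
      = Complex.exp (-(c ^ 2 * ‖t‖ ^ 2) / 2) := by
    intro c
    have := charFun_stdGaussian (c • t)
    rw [charFun_apply, norm_smul] at this
    simp_rw [inner_smul_right] at this
    simp_rw [real_inner_smul_left]
    rw [this]
    push_cast
    rw [mul_pow, ← Complex.ofReal_pow ‖c‖, Real.norm_eq_abs, sq_abs]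
    push_cast
    rfl
  rw [charFun_apply, charFun_apply, integral_map (by fun_prop) (by fun_prop),
    integral_map (by fun_prop) (by fun_prop), hs]
  simp_rw [inner_add_left, Complex.ofReal_add, add_mul, Complex.exp_add]
  rw [integral_prod_mul (fun z : E => Complex.exp ((inner ℝ (σ • z) t : ℝ) * Complex.I))
    (fun z : E => Complex.exp ((inner ℝ (τ • z) t : ℝ) * Complex.I)), hs, hs, ← Complex.exp_add]
  congr 1
  have : (σ : ℂ) ^ 2 + (τ : ℂ) ^ 2 = (ρ : ℂ) ^ 2 := by exact_mod_cast h
  rw [← this]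
  ring

theorem integrable_prod_comp_stdGaussian (hg : LipschitzWith L g) (σ τ : ℝ) (x : E) :
    Integrable (fun p : E × E => g (x + σ • p.1 + τ • p.2))
      ((stdGaussian E).prod (stdGaussian E)) := by
  have hc := hg.continuous
  refine ((integrable_const |g x|).add
    (((integrable_norm_stdGaussian.const_mul (L * |σ|)).comp_fst _).add
      ((integrable_norm_stdGaussian.const_mul (L * |τ|)).comp_snd _))).mono' (by fun_prop)
      (ae_of_all _ fun z => ?_)
  have := abs_add_le_of_lipschitzWith hg x (σ • z.1 + τ • z.2)
  have h2 := norm_add_le (σ • z.1) (τ • z.2)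
  rw [norm_smul, norm_smul, Real.norm_eq_abs, Real.norm_eq_abs] at h2
  simp only [Pi.add_apply, Real.norm_eq_abs, ← add_assoc] at this ⊢
  nlinarith [L.coe_nonneg, mul_le_mul_of_nonneg_left h2 L.coe_nonneg]

/-- Semigroup property of Gaussian smoothing. -/
theorem gaussSmooth_gaussSmooth (hg : LipschitzWith L g) {σ τ ρ : ℝ≥0}
    (h : σ ^ 2 + τ ^ 2 = ρ ^ 2) : gaussSmooth σ (gaussSmooth τ g) = gaussSmooth ρ g := by
  have hc := hg.continuous
  ext x
  have h' : (σ : ℝ) ^ 2 + (τ : ℝ) ^ 2 = (ρ : ℝ) ^ 2 := by exact_mod_cast h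
  have e : gaussSmooth ρ g x = ∫ y, g (x + y) ∂((stdGaussian E).map (fun z => (ρ : ℝ) • z)) := by
    rw [integral_map (by fun_prop) (by fun_prop), gaussSmooth]
  rw [e, ← map_prod_stdGaussian _ _ _ h', integral_map (by fun_prop) (by fun_prop)]
  simp_rw [← add_assoc]
  rw [integral_prod _ (integrable_prod_comp_stdGaussian hg _ _ _)]
  rfl

/-- The derivative and the smoothing of a Lipschitz function commute. -/
theorem gaussSmooth_gaussGrad (hg : LipschitzWith L g) (σ τ : ℝ≥0) (u : E) :
    gaussSmooth τ (gaussGrad σ u g) = gaussGrad σ u (gaussSmooth τ g) := by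
  have hc := hg.continuous
  ext x
  simp only [gaussSmooth, gaussGrad]
  rw [integral_integral_swap]
  · refine integral_congr_ae (ae_of_all _ fun z => ?_)
    simp only
    rw [integral_mul_const]
    simp_rw [add_right_comm]
  · have h1 := integrable_norm_stdGaussian (E := E)
    have h2 := integrable_norm_pow_stdGaussian (E := E) 2
    refine ((h1.const_mul (|g x| * (‖u‖ / σ))).comp_snd (stdGaussian E) |>.add
      (((h1.mul_prod h1).const_mul (L * τ * (‖u‖ / σ))).add
      ((h2.const_mul (L * σ * (‖u‖ / σ))).comp_snd (stdGaussian E)))).mono' (by fun_prop)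
      (ae_of_all _ fun z => ?_)
    have e1 := abs_add_le_of_lipschitzWith hg x ((τ : ℝ) • z.1 + (σ : ℝ) • z.2)
    have e2 := norm_add_le ((τ : ℝ) • z.1) ((σ : ℝ) • z.2)
    rw [norm_smul, norm_smul, Real.norm_eq_abs, Real.norm_eq_abs, NNReal.abs_eq,
      NNReal.abs_eq] at e2
    have e3 := abs_inner_div_le σ u z.2
    have e4 : |g (x + (τ : ℝ) • z.1 + (σ : ℝ) • z.2)| ≤
        |g x| + L * (τ * ‖z.1‖ + σ * ‖z.2‖) := by
      rw [add_assoc]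
      exact e1.trans (by gcongr)
    simp only [Function.uncurry, Pi.add_apply, Real.norm_eq_abs]
    rw [abs_mul]
    calc _ ≤ (|g x| + L * (τ * ‖z.1‖ + σ * ‖z.2‖)) * (‖u‖ / σ * ‖z.2‖) := by gcongr
      _ = _ := by ring

/-- The derivative at scale `σ` of a function smoothed at scale `τ` is the derivative of the
function at the combined scale. -/
theorem gaussGrad_gaussSmooth (hg : LipschitzWith L g) {σ τ ρ : ℝ≥0} (hσ : σ ≠ 0) (hρ : ρ ≠ 0)
    (h : σ ^ 2 + τ ^ 2 = ρ ^ 2) (u : E) :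
    gaussGrad σ u (gaussSmooth τ g) = gaussGrad ρ u g := by
  ext x
  have h1 := hasDerivAt_gaussSmooth σ hσ (lipschitzWith_gaussSmooth hg τ) u x 0
  rw [gaussSmooth_gaussSmooth hg h] at h1
  have h2 := hasDerivAt_gaussSmooth ρ hρ hg u x 0
  simpa using h1.unique h2

theorem gaussGrad_sum_smul {ι : Type*} (s : Finset ι) (hg : LipschitzWith L g) (σ : ℝ≥0)
    (c : ι → ℝ) (e : ι → E) (x : E) :
    gaussGrad σ (∑ i ∈ s, c i • e i) g x = ∑ i ∈ s, c i * gaussGrad σ (e i) g x := by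
  simp only [gaussGrad]
  simp_rw [← integral_const_mul]
  rw [← integral_finsetSum _ fun i _ => (integrable_mul_inner_stdGaussian hg σ (e i) x).const_mul _]
  refine integral_congr_ae (ae_of_all _ fun z => ?_)
  simp only [sum_inner, real_inner_smul_left, Finset.sum_div, Finset.mul_sum]
  exact Finset.sum_congr rfl fun i _ => by ring

theorem gaussGrad_apply_sum {ι : Type*} (s : Finset ι) {f : ι → E → ℝ} {K : ι → ℝ≥0}
    (hf : ∀ i, LipschitzWith (K i) (f i)) (σ : ℝ≥0) (c : ι → ℝ) (u x : E) :
    gaussGrad σ u (fun y => ∑ i ∈ s, c i * f i y) x = ∑ i ∈ s, c i * gaussGrad σ u (f i) x := by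
  simp only [gaussGrad]
  simp_rw [← integral_const_mul]
  rw [← integral_finsetSum _ fun i _ => (integrable_mul_inner_stdGaussian (hf i) σ u x).const_mul _]
  refine integral_congr_ae (ae_of_all _ fun z => ?_)
  simp only [Finset.sum_mul]
  exact Finset.sum_congr rfl fun i _ => by ring

end Smoothing

/-! ### Second-order expansion of the heat semigroup -/

theorem abs_taylor_two_le {f f' f'' : ℝ → ℝ} {K : ℝ} (hf : ∀ t, HasDerivAt f (f' t) t)
    (hf' : ∀ t, HasDerivAt f' (f'' t) t)
    (hK : ∀ t ∈ Set.Icc (0 : ℝ) 1, |f'' t - f'' 0| ≤ K) :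
    |f 1 - f 0 - f' 0 - f'' 0 / 2| ≤ K := by
  have mem0 : (0 : ℝ) ∈ Set.Icc (0 : ℝ) 1 := by simp
  have hK0 : 0 ≤ K := (abs_nonneg _).trans (hK 0 mem0)
  have h1 : ∀ t ∈ Set.Icc (0 : ℝ) 1, |f' t - f' 0 - t * f'' 0| ≤ K := by
    intro t ht
    have := Convex.norm_image_sub_le_of_norm_hasDerivWithin_le (𝕜 := ℝ) (s := Set.Icc (0 : ℝ) 1)
      (f := fun t => f' t - t * f'' 0) (f' := fun t => f'' t - 1 * f'' 0) (C := K)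
      (fun x _ => ((hf' x).sub ((hasDerivAt_id x).mul_const _)).hasDerivWithinAt)
      (fun x hx => by simpa using hK x hx) (convex_Icc 0 1) mem0 ht
    rw [Real.norm_eq_abs, Real.norm_eq_abs, sub_zero, abs_of_nonneg ht.1] at this
    calc |f' t - f' 0 - t * f'' 0| = |f' t - t * f'' 0 - (f' 0 - 0 * f'' 0)| := by ring_nf
      _ ≤ K * t := this
      _ ≤ K := mul_le_of_le_one_right hK0 ht.2
  have := Convex.norm_image_sub_le_of_norm_hasDerivWithin_le (𝕜 := ℝ) (s := Set.Icc (0 : ℝ) 1)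
      (f := fun t => f t - t * f' 0 - t ^ 2 * (f'' 0 / 2))
      (f' := fun t => f' t - 1 * f' 0 - (2 * t) * (f'' 0 / 2)) (C := K)
      (fun x _ => (((hf x).sub ((hasDerivAt_id x).mul_const _)).sub
        (((hasDerivAt_pow 2 x).congr_deriv (by simp)).mul_const _)).hasDerivWithinAt)
      (fun x hx => by
        rw [Real.norm_eq_abs]
        convert h1 x hx using 2
        ring) (convex_Icc 0 1) mem0 (by simp : (1 : ℝ) ∈ Set.Icc (0 : ℝ) 1)
  rw [Real.norm_eq_abs, Real.norm_eq_abs] at this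
  calc |f 1 - f 0 - f' 0 - f'' 0 / 2|
      = |f 1 - 1 * f' 0 - 1 ^ 2 * (f'' 0 / 2) - (f 0 - 0 * f' 0 - 0 ^ 2 * (f'' 0 / 2))| := by
        ring_nf
    _ ≤ K * |1 - 0| := this
    _ = K := by simp

section Heat

variable {E : Type*} [NormedAddCommGroup E] [InnerProductSpace ℝ E] [FiniteDimensional ℝ E]
  [MeasurableSpace E] [BorelSpace E]

/-- The heat semigroup at time `s`: `x ↦ 𝔼 g (x + √s Z)` for a standard Gaussian `Z`. -/
noncomputable def heat (s : ℝ≥0) (g : E → ℝ) : E → ℝ := gaussSmooth (NNReal.sqrt s) g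

/-- The second derivative of `heat s g` in the directions `u` and `v`, obtained by spending half of
the time `s` on each integration by parts. -/
noncomputable def heatHess (s : ℝ≥0) (u v : E) (g : E → ℝ) : E → ℝ :=
  gaussGrad (NNReal.sqrt (s / 2)) u (gaussGrad (NNReal.sqrt (s / 2)) v g)

variable {L : ℝ≥0} {g : E → ℝ} {s : ℝ≥0}

theorem lipschitzWith_heatHess (hg : LipschitzWith L g) (u v : E) :
    LipschitzWith (L * (2 * gaussMeanNorm E ^ 2 * ‖u‖₊ * ‖v‖₊) / s) (heatHess s u v g) := by
  have h := lipschitzWith_gaussGrad (lipschitzWith_gaussGrad hg (NNReal.sqrt (s / 2)) v)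
    (NNReal.sqrt (s / 2)) u
  refine h.weaken (le_of_eq ?_)
  have e : s = 2 * (NNReal.sqrt (s / 2) * NNReal.sqrt (s / 2)) := by
    rw [NNReal.mul_self_sqrt, mul_div_cancel₀ _ two_ne_zero]
  rcases eq_or_ne s 0 with rfl | hs
  · simp
  · have : NNReal.sqrt (s / 2) ≠ 0 := by simpa using hs
    set τ := NNReal.sqrt (s / 2)
    rw [e]
    field_simp

/-- The restriction to times `s ≥ 1` trades the decay `s ^ (-1 / 2)` for a uniform bound. -/
theorem abs_heatHess_le (hg : LipschitzWith L g) (hs : 1 ≤ s) (u v x : E) :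
    |heatHess s u v g x| ≤ L * (2 * gaussMeanNorm E * ‖u‖ * ‖v‖) := by
  have hpos : 0 < s := zero_lt_one.trans_le hs
  have h := abs_gaussGrad_le (NNReal.sqrt (s / 2)) (by simpa using hpos.ne')
    (lipschitzWith_gaussGrad hg (NNReal.sqrt (s / 2)) v) u x
  refine h.trans ?_
  have h2 : (2 : ℝ)⁻¹ ≤ NNReal.sqrt (s / 2) := by
    rw [Real.coe_sqrt]
    refine Real.le_sqrt_of_sq_le ?_
    have : (1 : ℝ) ≤ s := by exact_mod_cast hs
    push_cast
    linarith
  push_cast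
  rw [Real.coe_sqrt] at h2
  push_cast at h2
  have h3 : ‖v‖ / √(s / 2) ≤ 2 * ‖v‖ := by
    rw [div_le_iff₀ (by linarith)]
    nlinarith [norm_nonneg v]
  calc _ ≤ L * (2 * ‖v‖ * gaussMeanNorm E) * ‖u‖ := by gcongr
    _ = _ := by ring

theorem gaussSmooth_heat (hg : LipschitzWith L g) (σ s : ℝ≥0) :
    gaussSmooth σ (heat s g) = heat (s + σ ^ 2) g :=
  gaussSmooth_gaussSmooth hg (by rw [NNReal.sq_sqrt, NNReal.sq_sqrt, add_comm])

theorem lipschitzWith_heat (hg : LipschitzWith L g) (s : ℝ≥0) : LipschitzWith L (heat s g) :=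
  lipschitzWith_gaussSmooth hg _

/-- Half of the smoothing time differentiates, the other half keeps smoothing, so that the first
derivative can be differentiated once more. -/
theorem gaussGrad_sqrt_eq (hg : LipschitzWith L g) (hs : s ≠ 0) (u : E) :
    gaussGrad (NNReal.sqrt s) u g =
      gaussSmooth (NNReal.sqrt (s / 2)) (gaussGrad (NNReal.sqrt (s / 2)) u g) := by
  rw [gaussSmooth_gaussGrad hg, gaussGrad_gaussSmooth hg (ρ := NNReal.sqrt s)
    (by simpa using hs) (by simpa using hs) (by simp only [NNReal.sq_sqrt, add_halves])]

/-- Second-order Taylor expansion of the heat semigroup; the remainder gains a factor `1 / s` from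
the Gaussian smoothing of a function that is merely Lipschitz. -/
theorem abs_heat_taylor_le (hg : LipschitzWith L g) (hs : s ≠ 0) (x u : E) :
    |heat s g (x + u) - heat s g x - gaussGrad (NNReal.sqrt s) u g x - heatHess s u u g x / 2|
      ≤ L * (2 * gaussMeanNorm E ^ 2) / s * ‖u‖ ^ 3 := by
  have h := abs_taylor_two_le (f := fun t : ℝ => heat s g (x + t • u))
    (f' := fun t => gaussGrad (NNReal.sqrt s) u g (x + t • u))
    (f'' := fun t => heatHess s u u g (x + t • u))
    (K := L * (2 * gaussMeanNorm E ^ 2) / s * ‖u‖ ^ 3)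
    (fun t => hasDerivAt_gaussSmooth _ (by simpa using hs) hg u x t)
    (fun t => by
      rw [gaussGrad_sqrt_eq hg hs]
      exact hasDerivAt_gaussSmooth _ (by simpa using hs) (lipschitzWith_gaussGrad hg _ u) u x t)
    (fun t ht => by
      have := abs_sub_le_of_lipschitzWith (lipschitzWith_heatHess (s := s) hg u u)
        (x + t • u) (x + (0 : ℝ) • u)
      refine this.trans ?_
      rw [zero_smul, add_zero, add_sub_cancel_left, norm_smul, Real.norm_eq_abs,
        abs_of_nonneg ht.1]
      push_cast
      calc _ ≤ (L * (2 * gaussMeanNorm E ^ 2 * ‖u‖ * ‖u‖) / s : ℝ) * (1 * ‖u‖) := by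
            gcongr
            exact ht.2
        _ = _ := by ring)
  simpa using h

/-- Increasing the time by one changes the Hessian of the heat semigroup by `O(1 / s)`. -/
theorem abs_heatHess_add_one_sub_le (hg : LipschitzWith L g) (hs : s ≠ 0) (u v x : E) :
    |heatHess (s + 1) u v g x - heatHess s u v g x| ≤
      2 * gaussMeanNorm E * (L * (2 * gaussMeanNorm E ^ 2 * ‖u‖ * ‖v‖) / s) := by
  set τ : ℝ≥0 := NNReal.sqrt (1 / 2) with hτ
  have hτ1 : (τ : ℝ) ≤ 1 := by
    rw [hτ, Real.coe_sqrt, Real.sqrt_le_iff]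
    norm_num
  have hσ : NNReal.sqrt (s / 2) ≠ 0 := by simpa using hs
  have hρ : NNReal.sqrt ((s + 1) / 2) ≠ 0 := by simp
  have hadd : NNReal.sqrt (s / 2) ^ 2 + τ ^ 2 = NNReal.sqrt ((s + 1) / 2) ^ 2 := by
    rw [hτ]
    simp only [NNReal.sq_sqrt, add_div]
  have hlip := lipschitzWith_gaussGrad hg (NNReal.sqrt (s / 2)) v
  have e : heatHess (s + 1) u v g = gaussSmooth τ (gaussSmooth τ (heatHess s u v g)) := by
    unfold heatHess
    rw [← gaussGrad_gaussSmooth hg hσ hρ hadd, ← gaussSmooth_gaussGrad hg,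
      ← gaussGrad_gaussSmooth (lipschitzWith_gaussSmooth hlip τ) hσ hρ hadd,
      gaussSmooth_gaussGrad hlip, gaussSmooth_gaussGrad (lipschitzWith_gaussSmooth hlip τ)]
  have hl := lipschitzWith_heatHess (s := s) hg u v
  have h1 := abs_gaussSmooth_sub_le (lipschitzWith_gaussSmooth hl τ) τ x
  have h2 := abs_gaussSmooth_sub_le hl τ x
  rw [e]
  push_cast at h1 h2
  refine (abs_sub_le _ (gaussSmooth τ (heatHess s u v g) x) _).trans ?_
  set Q : ℝ := L * (2 * gaussMeanNorm E ^ 2 * ‖u‖ * ‖v‖) / s with hQ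
  have hQ0 : 0 ≤ Q := by positivity
  have h3 : Q * τ * gaussMeanNorm E ≤ Q * 1 * gaussMeanNorm E := by gcongr
  linarith

end Heat

section Coordinates

variable {d : ℕ} {L : ℝ≥0} {g : Vec d → ℝ} {s : ℝ≥0}

/-- The standard basis vectors of `Vec d`. -/
noncomputable abbrev stdVec (a : Fin d) : Vec d := EuclideanSpace.single a 1

theorem sum_smul_stdVec (u : Vec d) : ∑ a, u a • stdVec a = u := by
  ext b
  simp [stdVec, Pi.single_apply]

theorem gaussGrad_eq_sum (hg : LipschitzWith L g) (σ : ℝ≥0) (u x : Vec d) :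
    gaussGrad σ u g x = ∑ a, u a * gaussGrad σ (stdVec a) g x := by
  rw [← gaussGrad_sum_smul _ hg, sum_smul_stdVec]

theorem heatHess_eq_sum (hg : LipschitzWith L g) (u x : Vec d) :
    heatHess s u u g x = ∑ a, ∑ b, u a * u b * heatHess s (stdVec a) (stdVec b) g x := by
  unfold heatHess
  have h : gaussGrad (NNReal.sqrt (s / 2)) u g =
      fun y => ∑ b, u b * gaussGrad (NNReal.sqrt (s / 2)) (stdVec b) g y :=
    funext fun y => gaussGrad_eq_sum hg _ u y
  rw [gaussGrad_eq_sum (lipschitzWith_gaussGrad hg _ u)]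
  refine Finset.sum_congr rfl fun a _ => ?_
  rw [h, gaussGrad_apply_sum _ (fun b => lipschitzWith_gaussGrad hg _ (stdVec b)), Finset.mul_sum]
  exact Finset.sum_congr rfl fun b _ => by ring

theorem integrable_coord_stdGaussian (a : Fin d) :
    Integrable (fun z : Vec d => z a) (stdGaussian (Vec d)) :=
  integrable_norm_stdGaussian.mono' (by fun_prop) (ae_of_all _ fun z => PiLp.norm_apply_le z a)

theorem integral_coord_stdGaussian (a : Fin d) :
    ∫ z : Vec d, z a ∂(stdGaussian (Vec d)) = 0 := by
  have h := integral_strongDual_stdGaussian (E := Vec d) (EuclideanSpace.proj a)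
  simpa using h

theorem integrable_coord_mul_stdGaussian (a b : Fin d) :
    Integrable (fun z : Vec d => z a * z b) (stdGaussian (Vec d)) := by
  refine (integrable_norm_pow_stdGaussian 2).mono' (by fun_prop) (ae_of_all _ fun z => ?_)
  rw [norm_mul, pow_two]
  gcongr <;> exact PiLp.norm_apply_le z _

theorem integral_coord_mul_stdGaussian (a b : Fin d) :
    ∫ z : Vec d, z a * z b ∂(stdGaussian (Vec d)) = if a = b then 1 else 0 := by
  have h := covarianceBilin_apply (μ := stdGaussian (Vec d)) IsGaussian.memLp_two_id
    (stdVec a) (stdVec b)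
  rw [covarianceBilin_stdGaussian] at h
  simp only [id, integral_id_stdGaussian, sub_zero] at h
  simp only [stdVec, EuclideanSpace.inner_single_left, map_one, one_mul] at h
  rw [← h, innerSL_apply_apply, EuclideanSpace.inner_single_left]
  simp

/-- The generator of the heat semigroup, up to `O(1 / s)`, is half of the Laplacian. -/
theorem abs_heat_add_one_sub_le (hg : LipschitzWith L g) (hs : s ≠ 0) (x : Vec d) :
    |heat (s + 1) g x - heat s g x - (∑ a, heatHess s (stdVec a) (stdVec a) g x) / 2| ≤
      L * (2 * gaussMeanNorm (Vec d) ^ 2) / s * ∫ z : Vec d, ‖z‖ ^ 3 ∂(stdGaussian (Vec d)) := by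
  have h1 : heat (s + 1) g x = ∫ z, heat s g (x + z) ∂(stdGaussian (Vec d)) := by
    have := congrFun (gaussSmooth_heat hg 1 s) x
    rw [one_pow] at this
    rw [← this]
    simp [gaussSmooth]
  have i1 : Integrable (fun z => heat s g (x + z)) (stdGaussian (Vec d)) := by
    simpa using integrable_comp_add_smul_stdGaussian (lipschitzWith_heat hg s) 1 x
  have e2 : (fun z : Vec d => gaussGrad (NNReal.sqrt s) z g x) =
      fun z => ∑ a, z a * gaussGrad (NNReal.sqrt s) (stdVec a) g x :=
    funext fun z => gaussGrad_eq_sum hg _ z x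
  have e3 : (fun z : Vec d => heatHess s z z g x) =
      fun z => ∑ a, ∑ b, z a * z b * heatHess s (stdVec a) (stdVec b) g x :=
    funext fun z => heatHess_eq_sum hg z x
  have i2 : Integrable (fun z => gaussGrad (NNReal.sqrt s) z g x) (stdGaussian (Vec d)) := by
    rw [e2]
    exact integrable_finsetSum _ fun a _ => (integrable_coord_stdGaussian a).mul_const _
  have h2 : ∫ z, gaussGrad (NNReal.sqrt s) z g x ∂(stdGaussian (Vec d)) = 0 := by
    rw [e2]
    rw [integral_finsetSum _ fun a _ => (integrable_coord_stdGaussian a).mul_const _]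
    simp_rw [integral_mul_const, integral_coord_stdGaussian]
    simp
  have i3 : Integrable (fun z => heatHess s z z g x) (stdGaussian (Vec d)) := by
    rw [e3]
    exact integrable_finsetSum _ fun a _ => integrable_finsetSum _ fun b _ =>
      (integrable_coord_mul_stdGaussian a b).mul_const _
  have h3 : ∫ z, heatHess s z z g x ∂(stdGaussian (Vec d)) =
      ∑ a, heatHess s (stdVec a) (stdVec a) g x := by
    rw [e3]
    rw [integral_finsetSum _ fun a _ => integrable_finsetSum _ fun b _ =>
      (integrable_coord_mul_stdGaussian a b).mul_const _]
    refine Finset.sum_congr rfl fun a _ => ?_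
    rw [integral_finsetSum _ fun b _ => (integrable_coord_mul_stdGaussian a b).mul_const _]
    simp_rw [integral_mul_const, integral_coord_mul_stdGaussian]
    simp
  have h4 : heat (s + 1) g x - heat s g x - (∑ a, heatHess s (stdVec a) (stdVec a) g x) / 2 =
      ∫ z, (heat s g (x + z) - heat s g x - gaussGrad (NNReal.sqrt s) z g x
        - heatHess s z z g x / 2) ∂(stdGaussian (Vec d)) := by
    have j1 : Integrable (fun z => heat s g (x + z) - heat s g x) (stdGaussian (Vec d)) :=
      i1.sub (integrable_const _)
    have j2 : Integrable (fun z => heat s g (x + z) - heat s g x -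
      gaussGrad (NNReal.sqrt s) z g x) (stdGaussian (Vec d)) := j1.sub i2
    rw [integral_sub j2 (i3.div_const 2), integral_sub j1 i2, integral_sub i1 (integrable_const _),
      integral_div, h2, h3, h1]
    simp
  rw [h4, ← integral_const_mul, ← Real.norm_eq_abs]
  exact norm_integral_le_of_norm_le ((integrable_norm_pow_stdGaussian 3).const_mul _)
    (ae_of_all _ fun z => abs_heat_taylor_le hg hs x z)

end Coordinates

/-! ### Ergodicity and Poisson's equation for bounded functions -/

section Ergodic

variable {S : Type*} [Countable S] [MeasurableSpace S] [DiscreteMeasurableSpace S]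

omit [Countable S] in
theorem integrable_of_abs_le (p : Measure S) [IsFiniteMeasure p] {q : S → ℝ} {B : ℝ}
    (hq : ∀ x, |q x| ≤ B) : Integrable q p :=
  Integrable.of_bound (Measurable.of_discrete).aestronglyMeasurable B (ae_of_all _ hq)

theorem summable_measureReal_singleton (p : Measure S) [IsFiniteMeasure p] :
    Summable fun y => p.real {y} := by
  have h : Integrable (fun _ : S => (1 : ℝ)) p := integrable_const 1
  rw [← Measure.sum_smul_dirac p] at h
  simpa [measureReal_def] using h.summable_of_dirac

/-- The factor `2` compensates the `1 / 2` in the normalization of `tvDist`. -/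
theorem abs_integral_sub_integral_le (p q : Measure S) [IsProbabilityMeasure p]
    [IsProbabilityMeasure q] {f : S → ℝ} {B : ℝ} (hf : ∀ x, |f x| ≤ B) :
    |∫ x, f x ∂p - ∫ x, f x ∂q| ≤ 2 * B * tvDist p q := by
  have hs := (summable_measureReal_singleton p).sub (summable_measureReal_singleton q)
  have hsum : ∀ (r : S → ℝ), Summable (fun y => |r y|) → Summable fun y => |r y * f y| := by
    intro r hr
    refine Summable.of_nonneg_of_le (fun _ => abs_nonneg _) (fun y => ?_) (hr.mul_left B)
    rw [abs_mul, mul_comm]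
    exact mul_le_mul_of_nonneg_right (hf y) (abs_nonneg _)
  rw [integral_countable (integrable_of_abs_le p hf), integral_countable (integrable_of_abs_le q hf)]
  simp only [smul_eq_mul]
  rw [← Summable.tsum_sub (hsum _ (summable_measureReal_singleton p).abs).of_abs
    (hsum _ (summable_measureReal_singleton q).abs).of_abs]
  simp_rw [← sub_mul]
  have h1 := hsum _ hs.abs
  calc |∑' y, (p.real {y} - q.real {y}) * f y|
      ≤ ∑' y, |(p.real {y} - q.real {y}) * f y| := by
        simpa [Real.norm_eq_abs] using norm_tsum_le_tsum_norm (f := fun y =>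
          (p.real {y} - q.real {y}) * f y) h1
    _ ≤ ∑' y, B * |p.real {y} - q.real {y}| := by
        refine h1.tsum_le_tsum (fun y => ?_) (hs.abs.mul_left B)
        rw [abs_mul, mul_comm]
        exact mul_le_mul_of_nonneg_right (hf y) (abs_nonneg _)
    _ = 2 * B * tvDist p q := by
        rw [tsum_mul_left, tvDist]
        ring

instance isMarkovKernel_pow {S : Type*} [MeasurableSpace S] (P : Kernel S S) [IsMarkovKernel P]
    (n : ℕ) : IsMarkovKernel (P ^ n) := by
  induction n with
  | zero => exact inferInstanceAs (IsMarkovKernel Kernel.id)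
  | succ n ih => exact inferInstanceAs (IsMarkovKernel ((P ^ n) ∘ₖ P))

/-- Bounded solutions of Poisson's equation: under uniform geometric ergodicity the series
`∑ₙ (Pⁿ q - π q)` converges uniformly, with a bound that is linear in that of `q`. -/
theorem exists_bounded_poisson_solution (P : Kernel S S) [IsMarkovKernel P] (π : Measure S)
    [IsProbabilityMeasure π] (herg : IsUniformlyGeometricallyErgodic P π) :
    ∃ K : ℝ, 0 ≤ K ∧ ∀ (q : S → ℝ) (B : ℝ), (∀ x, |q x| ≤ B) →
      ∃ W : S → ℝ, (∀ x, |W x| ≤ K * B) ∧ ∀ x, W x - ∫ y, W y ∂(P x) = q x - ∫ y, q y ∂π := by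
  obtain ⟨K, hK, ρ, hρ0, hρ1, h⟩ := herg
  refine ⟨2 * K * (1 - ρ)⁻¹, by have := sub_pos.2 hρ1; positivity, fun q B hq => ?_⟩
  set D : ℕ → S → ℝ := fun n x => ∫ y, q y ∂((P ^ n) x) - ∫ y, q y ∂π with hD
  have hbd : ∀ n x, |D n x| ≤ 2 * B * K * ρ ^ n := fun n x => by
    have hB : 0 ≤ B := (abs_nonneg _).trans (hq x)
    refine (abs_integral_sub_integral_le ((P ^ n) x) π hq).trans ?_
    calc 2 * B * tvDist ((P ^ n) x) π ≤ 2 * B * (K * ρ ^ n) := by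
          gcongr
          exact h x n
      _ = _ := by ring
  have hgeo : Summable fun n : ℕ => 2 * B * K * ρ ^ n :=
    (summable_geometric_of_lt_one hρ0 hρ1).mul_left _
  have hsum : ∀ x, Summable fun n => D n x := fun x =>
    Summable.of_norm_bounded hgeo fun n => hbd n x
  refine ⟨fun x => ∑' n, D n x, fun x => ?_, fun x => ?_⟩
  · have := tsum_of_norm_bounded (f := fun n => D n x) ((hasSum_geometric_of_lt_one hρ0 hρ1).mul_left (2 * B * K))
      fun n => hbd n x
    rw [Real.norm_eq_abs] at this
    exact this.trans (le_of_eq (by ring))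
  · have hstep : ∀ n, ∫ y, D n y ∂(P x) = D (n + 1) x := fun n => by
      have hb : ∀ y, |∫ z, q z ∂((P ^ n) y)| ≤ B := fun y => by
        have := norm_integral_le_of_norm_le_const (μ := (P ^ n) y) (f := q) (ae_of_all _ hq)
        simpa using this
      simp only [hD]
      rw [integral_sub (integrable_of_abs_le _ hb) (integrable_const _)]
      have e : (P ^ (n + 1)) x = ((P ^ n) ∘ₖ P) x := by rw [pow_succ]; rfl
      have : IsProbabilityMeasure (((P ^ n) ∘ₖ P) x) := inferInstance
      rw [e, Kernel.integral_comp (integrable_of_abs_le _ hq)]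
      simp
    have hint : ∫ y, ∑' n, D n y ∂(P x) = ∑' n, D (n + 1) x := by
      have := hasSum_integral_of_summable_integral_norm (μ := P x) (F := D)
        (fun n => integrable_of_abs_le _ (hbd n))
        (Summable.of_nonneg_of_le (fun n => integral_nonneg fun _ => norm_nonneg _) (fun n => by
          have := norm_integral_le_of_norm_le_const (μ := P x) (f := fun y => ‖D n y‖)
            (ae_of_all _ fun y => (norm_norm _).trans_le (hbd n y))
          rw [probReal_univ, mul_one] at this
          exact (le_abs_self _).trans this) hgeo)
      rw [← this.tsum_eq]
      simp_rw [hstep]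
    simp only
    rw [hint, (hsum x).tsum_eq_zero_add]
    simp only [hD, pow_zero, add_sub_cancel_right]
    have : (1 : Kernel S S) x = Measure.dirac x := by
      change Kernel.id x = _
      rw [Kernel.id_apply]
    rw [this, integral_dirac]

end Ergodic

/-! ### The Markov property along the history -/

section History

variable {S Ω : Type*} [Countable S] [MeasurableSpace S] [DiscreteMeasurableSpace S]
  [MeasurableSpace Ω] {μ : Measure Ω} [IsProbabilityMeasure μ] {P : Kernel S S} [IsMarkovKernel P]
  {X : ℕ → Ω → S}

/-- The trajectory `(X₀, …, X_k)`. -/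
def history (X : ℕ → Ω → S) (k : ℕ) (ω : Ω) : Fin (k + 1) → S := fun i => X i ω

omit [Countable S] [DiscreteMeasurableSpace S] [IsProbabilityMeasure μ] [IsMarkovKernel P] in
theorem measurable_history (hX : IsMarkovChain P μ X) (k : ℕ) : Measurable (history X k) :=
  measurable_pi_lambda _ fun i => hX.measurable i

/-- Given the trajectory up to time `k`, the law of `X_{k+1}` is `P (X_k)`. -/
theorem map_history_next (hX : IsMarkovChain P μ X) (k : ℕ) :
    μ.map (fun ω => (history X k ω, X (k + 1) ω)) =
      (μ.map (history X k)) ⊗ₘ (P.comap (fun h => h (Fin.last k)) (measurable_pi_apply _)) := by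
  have hm := measurable_history hX k
  have hmX := hX.measurable (k + 1)
  have hp : IsProbabilityMeasure (μ.map (history X k)) :=
    Measure.isProbabilityMeasure_map hm.aemeasurable
  refine Measure.ext_of_singleton fun ⟨h, y⟩ => ?_
  rw [← Set.singleton_prod_singleton, Measure.compProd_apply_prod (.singleton _) (.singleton _),
    lintegral_singleton, Measure.map_apply (by fun_prop) ((MeasurableSet.singleton _).prod
      (.singleton _)), Measure.map_apply hm (.singleton _), Kernel.comap_apply]
  -- the Markov property is stated for infinite sequences; the values beyond `k + 1` are irrelevant
  set x : ℕ → S := fun i => if hi : i < k + 1 then h ⟨i, hi⟩ else y with hx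
  have hxj : ∀ j (hj : j < k + 1), x j = h ⟨j, hj⟩ := fun j hj => dif_pos hj
  have hxk : x k = h (Fin.last k) := by simp [hx, Fin.last]
  have hxk1 : x (k + 1) = y := by simp [hx]
  have e1 : history X k ⁻¹' {h} = {ω | ∀ j ≤ k, X j ω = x j} := by
    ext ω
    simp only [Set.mem_preimage, Set.mem_singleton_iff, Set.mem_ofPred_eq, funext_iff, history]
    refine ⟨fun H j hj => ?_, fun H i => ?_⟩
    · rw [hxj j (by omega)]
      exact H ⟨j, by omega⟩
    · rw [H i (by omega), hxj i i.2]
  have e2 : (fun ω => (history X k ω, X (k + 1) ω)) ⁻¹' ({h} ×ˢ {y}) =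
      {ω | ∀ j ≤ k + 1, X j ω = x j} := by
    have : (fun ω => (history X k ω, X (k + 1) ω)) ⁻¹' ({h} ×ˢ {y}) =
      history X k ⁻¹' {h} ∩ {ω | X (k + 1) ω = y} := rfl
    rw [this, e1]
    ext ω
    simp only [Set.mem_inter_iff, Set.mem_ofPred_eq]
    refine ⟨fun ⟨H1, H2⟩ j hj => ?_, fun H => ⟨fun j hj => H j (by omega), ?_⟩⟩
    · rcases Nat.le_succ_iff.1 hj with hj | rfl
      · exact H1 j hj
      · rw [H2, hxk1]
    · rw [H (k + 1) le_rfl, hxk1]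
  rw [e1, e2, hX.markov k x, hxk, hxk1, mul_comm]

/-- Conditioning on the past: `Y` is a function of `X₀, …, X_k`, and `X_{k+1}` is integrated out
with respect to `P (X_k)`. -/
theorem integral_next_eq (hX : IsMarkovChain P μ X) (k : ℕ) {E : Type*} {Y : Ω → E}
    {F : (Fin (k + 1) → S) → E} (hY : ∀ ω, Y ω = F (history X k ω)) {f : E → S → S → ℝ} {C : ℝ}
    (hf : ∀ e x y, |f e x y| ≤ C) :
    ∫ ω, f (Y ω) (X k ω) (X (k + 1) ω) ∂μ = ∫ ω, ∫ y, f (Y ω) (X k ω) y ∂(P (X k ω)) ∂μ := by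
  have hm := measurable_history hX k
  have hmX := hX.measurable (k + 1)
  have hp : IsProbabilityMeasure (μ.map (history X k)) :=
    Measure.isProbabilityMeasure_map hm.aemeasurable
  set G : (Fin (k + 1) → S) × S → ℝ := fun p => f (F p.1) (p.1 (Fin.last k)) p.2 with hG
  have hGm : Measurable G := Measurable.of_discrete
  have hl : ∀ ω, X k ω = history X k ω (Fin.last k) := fun ω => by simp [history]
  calc ∫ ω, f (Y ω) (X k ω) (X (k + 1) ω) ∂μ
      = ∫ ω, G (history X k ω, X (k + 1) ω) ∂μ := by simp only [hG, hY, hl]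
    _ = ∫ p, G p ∂(μ.map (fun ω => (history X k ω, X (k + 1) ω))) := by
        rw [integral_map (by fun_prop) hGm.aestronglyMeasurable]
    _ = ∫ h, ∫ y, G (h, y) ∂(P (h (Fin.last k))) ∂(μ.map (history X k)) := by
        rw [map_history_next hX, Measure.integral_compProd]
        · rfl
        · exact Integrable.of_bound hGm.aestronglyMeasurable C (ae_of_all _ fun p => hf _ _ _)
    _ = ∫ ω, ∫ y, f (Y ω) (X k ω) y ∂(P (X k ω)) ∂μ := by
        rw [integral_map hm.aemeasurable (Measurable.of_discrete).aestronglyMeasurable]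
        simp only [hG, hY, hl]

end History

/-! ### The Lindeberg argument -/

section Increments

variable {S Ω : Type*} [Countable S] [MeasurableSpace S] [DiscreteMeasurableSpace S]
  [MeasurableSpace Ω] {μ : Measure Ω} [IsProbabilityMeasure μ] {P : Kernel S S} [IsMarkovKernel P]
  {X : ℕ → Ω → S} {d : ℕ} {v : S → Vec d} {B : ℝ}

/-- The martingale increment `v y - (P v) x` of a transition from `x` to `y`. -/
noncomputable def increment (P : Kernel S S) (v : S → Vec d) (x y : S) : Vec d :=
  v y - transitionMean P v x

/-- The partial sums `∑_{k < n} (v (X_{k+1}) - (P v) (X_k))` of the martingale increments. -/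
noncomputable def martSum (P : Kernel S S) (v : S → Vec d) (X : ℕ → Ω → S) (n : ℕ) (ω : Ω) :
    Vec d :=
  ∑ k ∈ Finset.range n, increment P v (X k ω) (X (k + 1) ω)

/-- The conditional covariance of the martingale increment of a transition from `x`. -/
noncomputable def incrementCov (P : Kernel S S) (v : S → Vec d) (a b : Fin d) (x : S) : ℝ :=
  ∫ y, increment P v x y a * increment P v x y b ∂(P x)

omit [Countable S] in
theorem integrable_of_norm_le (p : Measure S) [IsFiniteMeasure p] (hv : ∀ x, ‖v x‖ ≤ B) :
    Integrable v p :=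
  Integrable.of_bound (Measurable.of_discrete).aestronglyMeasurable B (ae_of_all _ hv)

omit [Countable S] [DiscreteMeasurableSpace S] in
theorem norm_increment_le (hv : ∀ x, ‖v x‖ ≤ B) (x y : S) : ‖increment P v x y‖ ≤ 2 * B := by
  have h : ‖transitionMean P v x‖ ≤ B := by
    simpa [transitionMean] using
      norm_integral_le_of_norm_le_const (μ := P x) (f := v) (ae_of_all _ hv)
  exact (norm_sub_le _ _).trans (by linarith [hv y])

omit [Countable S] [DiscreteMeasurableSpace S] in
theorem abs_increment_apply_le (hv : ∀ x, ‖v x‖ ≤ B) (x y : S) (a : Fin d) :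
    |increment P v x y a| ≤ 2 * B :=
  (PiLp.norm_apply_le _ a).trans (norm_increment_le hv x y)

omit [Countable S] [DiscreteMeasurableSpace S] in
theorem abs_increment_mul_le (hv : ∀ x, ‖v x‖ ≤ B) (x y : S) (a b : Fin d) :
    |increment P v x y a * increment P v x y b| ≤ (2 * B) ^ 2 := by
  rw [abs_mul, pow_two]
  have hB : 0 ≤ 2 * B := (norm_nonneg _).trans (norm_increment_le (P := P) hv x y)
  gcongr <;> exact abs_increment_apply_le hv x y _

omit [Countable S] [DiscreteMeasurableSpace S] in
theorem abs_incrementCov_le (hv : ∀ x, ‖v x‖ ≤ B) (a b : Fin d) (x : S) :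
    |incrementCov P v a b x| ≤ (2 * B) ^ 2 := by
  simpa [incrementCov] using norm_integral_le_of_norm_le_const (μ := P x)
    (f := fun y => increment P v x y a * increment P v x y b)
    (ae_of_all _ fun y => abs_increment_mul_le hv x y a b)

omit [Countable S] in
theorem integral_increment_apply (hv : ∀ x, ‖v x‖ ≤ B) (x : S) (a : Fin d) :
    ∫ y, increment P v x y a ∂(P x) = 0 := by
  have hi := integrable_of_norm_le (P x) hv
  have h := (EuclideanSpace.proj a : Vec d →L[ℝ] ℝ).integral_comp_comm
    (hi.sub (integrable_const (transitionMean P v x)))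
  rw [integral_sub' hi (integrable_const _)] at h
  simpa [increment, transitionMean] using h

omit [Countable S] [DiscreteMeasurableSpace S] [IsMarkovKernel P] [MeasurableSpace Ω] in
theorem martSum_eq_history (n : ℕ) : ∃ F : (Fin (n + 1) → S) → Vec d,
    ∀ ω, martSum P v X n ω = F (history X n ω) := by
  refine ⟨fun h => ∑ j ∈ Finset.range n,
    increment P v (h (Fin.ofNat (n + 1) j)) (h (Fin.ofNat (n + 1) (j + 1))), fun ω => ?_⟩
  refine Finset.sum_congr rfl fun j hj => ?_
  have hj := Finset.mem_range.1 hj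
  simp only [history, Fin.ofNat]
  rw [Nat.mod_eq_of_lt (by omega), Nat.mod_eq_of_lt (by omega)]

omit [IsProbabilityMeasure μ] [IsMarkovKernel P] in
theorem measurable_martSum (hX : IsMarkovChain P μ X) (n : ℕ) :
    Measurable (martSum P v X n) := by
  obtain ⟨F, hF⟩ := martSum_eq_history (P := P) (v := v) (X := X) n
  rw [show martSum P v X n = F ∘ history X n from funext hF]
  exact (Measurable.of_discrete (f := F)).comp (measurable_history hX n)

omit [Countable S] [DiscreteMeasurableSpace S] [MeasurableSpace Ω] in
theorem norm_martSum_le (hv : ∀ x, ‖v x‖ ≤ B) (n : ℕ) (ω : Ω) :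
    ‖martSum P v X n ω‖ ≤ n * (2 * B) := by
  refine (norm_sum_le_of_le _ fun k _ => norm_increment_le hv _ _).trans (by simp)

/-- Bounded increments make every Lipschitz function of the partial sums bounded. -/
theorem integrable_lipschitz_martSum (hX : IsMarkovChain P μ X) (hv : ∀ x, ‖v x‖ ≤ B) (n : ℕ)
    {L : ℝ≥0} {g : Vec d → ℝ} (hg : LipschitzWith L g) :
    Integrable (fun ω => g (martSum P v X n ω)) μ := by
  refine Integrable.of_bound
    (hg.continuous.measurable.comp (measurable_martSum hX n)).aestronglyMeasurable
    (|g 0| + L * (n * (2 * B))) (ae_of_all _ fun ω => ?_)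
  have h := abs_add_le_of_lipschitzWith hg 0 (martSum P v X n ω)
  rw [zero_add] at h
  refine h.trans ?_
  gcongr
  exact norm_martSum_le hv n ω

variable {L : ℝ≥0} {g : Vec d → ℝ} {s : ℝ≥0}

omit [IsMarkovKernel P] in
theorem integrable_heatHess_mul (hX : IsMarkovChain P μ X) (hg : LipschitzWith L g) (hs : 1 ≤ s)
    (u w : Vec d) (k j : ℕ) {f : S → ℝ} {C : ℝ} (hf : ∀ x, |f x| ≤ C) :
    Integrable (fun ω => heatHess s u w g (martSum P v X k ω) * f (X j ω)) μ := by
  refine Integrable.of_bound (((lipschitzWith_heatHess hg u w).continuous.measurable.comp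
    (measurable_martSum hX k)).mul ((Measurable.of_discrete (f := f)).comp
    (hX.measurable j))).aestronglyMeasurable (L * (2 * gaussMeanNorm (Vec d) * ‖u‖ * ‖w‖) * C)
    (ae_of_all _ fun ω => ?_)
  rw [norm_mul]
  exact mul_le_mul (abs_heatHess_le hg hs _ _ _) (hf _) (norm_nonneg _) (by positivity)

theorem norm_stdVec (a : Fin d) : ‖stdVec a‖ = 1 := by simp [stdVec]

/-- The first-order Taylor term vanishes because the increments are martingale differences. -/
theorem integral_gaussGrad_increment (hX : IsMarkovChain P μ X) (hv : ∀ x, ‖v x‖ ≤ B)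
    (hg : LipschitzWith L g) (hs : s ≠ 0) (k : ℕ) :
    ∫ ω, gaussGrad (NNReal.sqrt s) (increment P v (X k ω) (X (k + 1) ω)) g
      (martSum P v X k ω) ∂μ = 0 := by
  obtain ⟨F, hF⟩ := martSum_eq_history (P := P) (v := v) (X := X) k
  rw [integral_next_eq hX k hF
    (f := fun e x y => gaussGrad (NNReal.sqrt s) (increment P v x y) g e) (C := L * (2 * B))
    (fun e x y => (abs_gaussGrad_le _ (by simpa using hs) hg _ _).trans (by
      gcongr
      exact norm_increment_le hv x y))]
  have h : ∀ x e, ∫ y, gaussGrad (NNReal.sqrt s) (increment P v x y) g e ∂(P x) = 0 := by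
    intro x e
    have e2 : (fun y => gaussGrad (NNReal.sqrt s) (increment P v x y) g e) =
        fun y => ∑ a, increment P v x y a * gaussGrad (NNReal.sqrt s) (stdVec a) g e :=
      funext fun y => gaussGrad_eq_sum hg _ _ e
    rw [e2, integral_finsetSum _ fun a _ =>
      (integrable_of_abs_le _ fun y => abs_increment_apply_le hv x y a).mul_const _]
    simp_rw [integral_mul_const, integral_increment_apply hv]
    simp
  simp [h]

/-- The second-order Taylor term is governed by the conditional covariance of the increments. -/
theorem integral_heatHess_increment (hX : IsMarkovChain P μ X) (hv : ∀ x, ‖v x‖ ≤ B)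
    (hg : LipschitzWith L g) (hs : 1 ≤ s) (k : ℕ) :
    ∫ ω, heatHess s (increment P v (X k ω) (X (k + 1) ω)) (increment P v (X k ω) (X (k + 1) ω)) g
      (martSum P v X k ω) ∂μ = ∑ a, ∑ b, ∫ ω, heatHess s (stdVec a) (stdVec b) g
        (martSum P v X k ω) * incrementCov P v a b (X k ω) ∂μ := by
  obtain ⟨F, hF⟩ := martSum_eq_history (P := P) (v := v) (X := X) k
  rw [integral_next_eq hX k hF
    (f := fun e x y => heatHess s (increment P v x y) (increment P v x y) g e)
    (C := L * (2 * gaussMeanNorm (Vec d) * (2 * B) * (2 * B)))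
    (fun e x y => (abs_heatHess_le hg hs _ _ _).trans (by
      have h := norm_increment_le (P := P) hv x y
      have hB : 0 ≤ 2 * B := (norm_nonneg _).trans h
      gcongr))]
  have h : ∀ x e, ∫ y, heatHess s (increment P v x y) (increment P v x y) g e ∂(P x) =
      ∑ a, ∑ b, heatHess s (stdVec a) (stdVec b) g e * incrementCov P v a b x := by
    intro x e
    have e2 : (fun y => heatHess s (increment P v x y) (increment P v x y) g e) =
        fun y => ∑ a, ∑ b, increment P v x y a * increment P v x y b *
          heatHess s (stdVec a) (stdVec b) g e :=
      funext fun y => heatHess_eq_sum hg _ e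
    have hi : ∀ a b, Integrable (fun y => increment P v x y a * increment P v x y b *
        heatHess s (stdVec a) (stdVec b) g e) (P x) := fun a b =>
      (integrable_of_abs_le _ fun y => abs_increment_mul_le hv x y a b).mul_const _
    rw [e2, integral_finsetSum _ fun a _ => integrable_finsetSum _ fun b _ => hi a b]
    refine Finset.sum_congr rfl fun a _ => ?_
    rw [integral_finsetSum _ fun b _ => hi a b]
    refine Finset.sum_congr rfl fun b _ => ?_
    rw [integral_mul_const, mul_comm, incrementCov]
  simp_rw [h]
  have hi : ∀ a b, Integrable (fun ω => heatHess s (stdVec a) (stdVec b) g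
        (martSum P v X k ω) * incrementCov P v a b (X k ω)) μ := fun a b =>
    integrable_heatHess_mul hX hg hs _ _ k k (abs_incrementCov_le hv a b)
  rw [integral_finsetSum _ fun a _ => integrable_finsetSum _ fun b _ => hi a b]
  exact Finset.sum_congr rfl fun a _ => integral_finsetSum _ fun b _ => hi a b

/-- Expected effect of adding one martingale increment. -/
theorem abs_integral_heat_martSum_succ_sub_le (hX : IsMarkovChain P μ X) (hv : ∀ x, ‖v x‖ ≤ B)
    (hg : LipschitzWith L g) (hs : 1 ≤ s) (k : ℕ) :
    |∫ ω, heat s g (martSum P v X (k + 1) ω) ∂μ - ∫ ω, heat s g (martSum P v X k ω) ∂μ -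
      (∑ a, ∑ b, ∫ ω, heatHess s (stdVec a) (stdVec b) g (martSum P v X k ω) *
        incrementCov P v a b (X k ω) ∂μ) / 2| ≤
      L * (2 * gaussMeanNorm (Vec d) ^ 2) / s * (2 * B) ^ 3 := by
  have hs0 : s ≠ 0 := (zero_lt_one.trans_le hs).ne'
  have i1 := integrable_lipschitz_martSum hX hv (k + 1) (lipschitzWith_heat hg s)
  have i2 := integrable_lipschitz_martSum hX hv k (lipschitzWith_heat hg s)
  have hmS := measurable_martSum (v := v) hX k
  have hmi : ∀ a, Measurable fun ω => increment P v (X k ω) (X (k + 1) ω) a := fun a =>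
    (Measurable.of_discrete (f := fun p : S × S => increment P v p.1 p.2 a)).comp
      ((hX.measurable k).prodMk (hX.measurable (k + 1)))
  have i3 : Integrable (fun ω => gaussGrad (NNReal.sqrt s)
      (increment P v (X k ω) (X (k + 1) ω)) g (martSum P v X k ω)) μ := by
    refine Integrable.of_bound (Measurable.aestronglyMeasurable ?_) (L * (2 * B))
      (ae_of_all _ fun ω => (abs_gaussGrad_le _ (by simpa using hs0) hg _ _).trans (by
        gcongr
        exact norm_increment_le hv _ _))
    have e : (fun ω => gaussGrad (NNReal.sqrt s)
      (increment P v (X k ω) (X (k + 1) ω)) g (martSum P v X k ω)) = fun ω =>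
        ∑ a, increment P v (X k ω) (X (k + 1) ω) a *
          gaussGrad (NNReal.sqrt s) (stdVec a) g (martSum P v X k ω) :=
      funext fun ω => gaussGrad_eq_sum hg _ _ _
    rw [e]
    exact Finset.measurable_sum _ fun a _ => (hmi a).mul
      ((lipschitzWith_gaussGrad hg _ _).continuous.measurable.comp hmS)
  have i4 : Integrable (fun ω => heatHess s (increment P v (X k ω) (X (k + 1) ω))
      (increment P v (X k ω) (X (k + 1) ω)) g (martSum P v X k ω)) μ := by
    refine Integrable.of_bound (Measurable.aestronglyMeasurable ?_)
      (L * (2 * gaussMeanNorm (Vec d) * (2 * B) * (2 * B)))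
      (ae_of_all _ fun ω => (abs_heatHess_le hg hs _ _ _).trans (by
        have h := norm_increment_le (P := P) hv (X k ω) (X (k + 1) ω)
        have hB : 0 ≤ 2 * B := (norm_nonneg _).trans h
        gcongr))
    have e : (fun ω => heatHess s (increment P v (X k ω) (X (k + 1) ω))
      (increment P v (X k ω) (X (k + 1) ω)) g (martSum P v X k ω)) = fun ω =>
        ∑ a, ∑ b, increment P v (X k ω) (X (k + 1) ω) a * increment P v (X k ω) (X (k + 1) ω) b *
          heatHess s (stdVec a) (stdVec b) g (martSum P v X k ω) :=
      funext fun ω => heatHess_eq_sum hg _ _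
    rw [e]
    exact Finset.measurable_sum _ fun a _ => Finset.measurable_sum _ fun b _ =>
      ((hmi a).mul (hmi b)).mul
      ((lipschitzWith_heatHess hg _ _).continuous.measurable.comp hmS)
  rw [← integral_heatHess_increment hX hv hg hs k]
  have hsub : ∫ ω, heat s g (martSum P v X (k + 1) ω) ∂μ - ∫ ω, heat s g (martSum P v X k ω) ∂μ -
      (∫ ω, heatHess s (increment P v (X k ω) (X (k + 1) ω)) (increment P v (X k ω) (X (k + 1) ω)) g
      (martSum P v X k ω) ∂μ) / 2 =
      ∫ ω, (heat s g (martSum P v X (k + 1) ω) - heat s g (martSum P v X k ω) -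
        gaussGrad (NNReal.sqrt s) (increment P v (X k ω) (X (k + 1) ω)) g (martSum P v X k ω) -
        heatHess s (increment P v (X k ω) (X (k + 1) ω)) (increment P v (X k ω) (X (k + 1) ω)) g
      (martSum P v X k ω) / 2) ∂μ := by
    have j1 : Integrable (fun ω => heat s g (martSum P v X (k + 1) ω) -
      heat s g (martSum P v X k ω)) μ := i1.sub i2
    have j2 : Integrable (fun ω => heat s g (martSum P v X (k + 1) ω) -
      heat s g (martSum P v X k ω) - gaussGrad (NNReal.sqrt s)
      (increment P v (X k ω) (X (k + 1) ω)) g (martSum P v X k ω)) μ := j1.sub i3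
    rw [integral_sub j2 (i4.div_const 2), integral_sub j1 i3, integral_sub i1 i2, integral_div,
      integral_gaussGrad_increment hX hv hg hs0 k, sub_zero]
  have hC : L * (2 * gaussMeanNorm (Vec d) ^ 2) / s * (2 * B) ^ 3 =
      L * (2 * gaussMeanNorm (Vec d) ^ 2) / s * (2 * B) ^ 3 * μ.real Set.univ := by simp
  rw [hsub, hC, ← Real.norm_eq_abs]
  refine norm_integral_le_of_norm_le_const (ae_of_all _ fun ω => ?_)
  have e : martSum P v X (k + 1) ω = martSum P v X k ω + increment P v (X k ω) (X (k + 1) ω) :=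
    Finset.sum_range_succ _ _
  rw [e]
  refine (abs_heat_taylor_le hg hs0 _ _).trans ?_
  gcongr
  exact norm_increment_le hv _ _

/-- Expected effect of adding one unit of Gaussian noise. -/
theorem abs_integral_heat_add_one_sub_le (hX : IsMarkovChain P μ X) (hv : ∀ x, ‖v x‖ ≤ B)
    (hg : LipschitzWith L g) (hs : 1 ≤ s) (k : ℕ) :
    |∫ ω, heat (s + 1) g (martSum P v X k ω) ∂μ - ∫ ω, heat s g (martSum P v X k ω) ∂μ -
      (∑ a, ∫ ω, heatHess s (stdVec a) (stdVec a) g (martSum P v X k ω) ∂μ) / 2| ≤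
      L * (2 * gaussMeanNorm (Vec d) ^ 2) / s * ∫ z : Vec d, ‖z‖ ^ 3 ∂(stdGaussian (Vec d)) := by
  have hs0 : s ≠ 0 := (zero_lt_one.trans_le hs).ne'
  have i1 := integrable_lipschitz_martSum hX hv k (lipschitzWith_heat hg (s + 1))
  have i2 := integrable_lipschitz_martSum hX hv k (lipschitzWith_heat hg s)
  have i3 : ∀ a : Fin d, Integrable (fun ω =>
      heatHess s (stdVec a) (stdVec a) g (martSum P v X k ω)) μ := fun a =>
    integrable_lipschitz_martSum hX hv k (lipschitzWith_heatHess hg _ _)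
  have j1 : Integrable (fun ω => heat (s + 1) g (martSum P v X k ω) -
      heat s g (martSum P v X k ω)) μ := i1.sub i2
  rw [← integral_finsetSum _ fun a _ => i3 a, ← integral_sub i1 i2, ← integral_div,
    ← integral_sub j1 ((integrable_finsetSum _ fun a _ => i3 a).div_const 2)]
  set C := L * (2 * gaussMeanNorm (Vec d) ^ 2) / s * ∫ z : Vec d, ‖z‖ ^ 3 ∂(stdGaussian (Vec d))
  have hC : C = C * μ.real Set.univ := by simp
  rw [hC, ← Real.norm_eq_abs]
  exact norm_integral_le_of_norm_le_const (ae_of_all _ fun ω => abs_heat_add_one_sub_le hg hs0 _)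

variable {W : Fin d → Fin d → S → ℝ} {K : ℝ}

/-- Poisson's equation for the conditional covariance turns its deviation from the identity into a
difference of consecutive values of `W`. -/
theorem integral_heatHess_mul_incrementCov (hX : IsMarkovChain P μ X) (hv : ∀ x, ‖v x‖ ≤ B)
    (hg : LipschitzWith L g) (hs : 1 ≤ s) (hWb : ∀ a b x, |W a b x| ≤ K)
    (hW : ∀ a b x, W a b x - ∫ y, W a b y ∂(P x) =
      incrementCov P v a b x - if a = b then 1 else 0) (k : ℕ) (a b : Fin d) (u w : Vec d) :
    ∫ ω, heatHess s u w g (martSum P v X k ω) * incrementCov P v a b (X k ω) ∂μ -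
      (if a = b then ∫ ω, heatHess s u w g (martSum P v X k ω) ∂μ else 0) =
    ∫ ω, heatHess s u w g (martSum P v X k ω) * W a b (X k ω) ∂μ -
      ∫ ω, heatHess s u w g (martSum P v X k ω) * W a b (X (k + 1) ω) ∂μ := by
  obtain ⟨F, hF⟩ := martSum_eq_history (P := P) (v := v) (X := X) k
  have hPW : ∀ x, |∫ y, W a b y ∂(P x)| ≤ K := fun x => by
    simpa using norm_integral_le_of_norm_le_const (μ := P x) (f := W a b) (ae_of_all _ (hWb a b))
  have h1 : ∫ ω, heatHess s u w g (martSum P v X k ω) * W a b (X (k + 1) ω) ∂μ =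
      ∫ ω, heatHess s u w g (martSum P v X k ω) * ∫ y, W a b y ∂(P (X k ω)) ∂μ := by
    rw [integral_next_eq hX k hF (f := fun e x y => heatHess s u w g e * W a b y)
      (C := L * (2 * gaussMeanNorm (Vec d) * ‖u‖ * ‖w‖) * K)
      (fun e x y => by
        rw [abs_mul]
        exact mul_le_mul (abs_heatHess_le hg hs _ _ _) (hWb _ _ _) (abs_nonneg _) (by positivity))]
    simp_rw [integral_const_mul]
  have h2 : (if a = b then ∫ ω, heatHess s u w g (martSum P v X k ω) ∂μ else 0) =
      ∫ ω, heatHess s u w g (martSum P v X k ω) * (if a = b then 1 else 0) ∂μ := by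
    split_ifs <;> simp
  rw [h1, h2, ← integral_sub (integrable_heatHess_mul hX hg hs _ _ k k (abs_incrementCov_le hv a b))
    (integrable_heatHess_mul hX hg hs u w k k (f := fun _ => if a = b then 1 else 0) (C := 1)
      (fun _ => by split_ifs <;> simp)),
    ← integral_sub (integrable_heatHess_mul hX hg hs _ _ k k (hWb a b))
      (integrable_heatHess_mul hX hg hs _ _ k k hPW)]
  refine integral_congr_ae (ae_of_all _ fun ω => ?_)
  simp only
  rw [← mul_sub, ← mul_sub, hW]

end Increments

section Lindeberg

variable {S Ω : Type*} [Countable S] [MeasurableSpace S] [DiscreteMeasurableSpace S]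
  [MeasurableSpace Ω] {μ : Measure Ω} [IsProbabilityMeasure μ] {P : Kernel S S} [IsMarkovKernel P]
  {X : ℕ → Ω → S} {d : ℕ} {v : S → Vec d} {B : ℝ} {L : ℝ≥0} {g : Vec d → ℝ} {s : ℝ≥0}
  {W : Fin d → Fin d → S → ℝ} {K : ℝ}

/-- Half of the expected pairing of the Hessian of the heat semigroup at `martSum P v X k` with the
corrector `W` at `X k`. -/
noncomputable def correction (μ : Measure Ω) (P : Kernel S S) (v : S → Vec d) (X : ℕ → Ω → S)
    (W : Fin d → Fin d → S → ℝ) (g : Vec d → ℝ) (s : ℝ≥0) (k : ℕ) : ℝ :=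
  (∑ a, ∑ b, ∫ ω, heatHess s (stdVec a) (stdVec b) g (martSum P v X k ω) *
    W a b (X k ω) ∂μ) / 2

omit [Countable S] [DiscreteMeasurableSpace S] [IsMarkovKernel P] in
theorem abs_correction_le (hg : LipschitzWith L g) (hs : 1 ≤ s) (hWb : ∀ a b x, |W a b x| ≤ K)
    (k : ℕ) :
    |correction μ P v X W g s k| ≤ L * (d ^ 2 * gaussMeanNorm (Vec d) * K) := by
  have h : ∀ a b : Fin d, |∫ ω, heatHess s (stdVec a) (stdVec b) g (martSum P v X k ω) *
      W a b (X k ω) ∂μ| ≤ L * (2 * gaussMeanNorm (Vec d)) * K := fun a b => by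
    have := norm_integral_le_of_norm_le_const (μ := μ)
      (f := fun ω => heatHess s (stdVec a) (stdVec b) g (martSum P v X k ω) * W a b (X k ω))
      (C := L * (2 * gaussMeanNorm (Vec d)) * K) (ae_of_all _ fun ω => by
        rw [norm_mul]
        have h1 := abs_heatHess_le hg hs (stdVec a) (stdVec b) (martSum P v X k ω)
        rw [norm_stdVec, norm_stdVec, mul_one, mul_one] at h1
        exact mul_le_mul h1 (hWb _ _ _) (norm_nonneg _) (by positivity))
    simpa using this
  rw [correction, abs_div, abs_two, div_le_iff₀ two_pos]
  calc _ ≤ ∑ a : Fin d, ∑ b : Fin d, L * (2 * gaussMeanNorm (Vec d)) * K :=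
        (Finset.abs_sum_le_sum_abs _ _).trans (Finset.sum_le_sum fun a _ =>
          (Finset.abs_sum_le_sum_abs _ _).trans (Finset.sum_le_sum fun b _ => h a b))
    _ = _ := by
        simp only [Finset.sum_const, Finset.card_univ, Fintype.card_fin, nsmul_eq_mul]
        ring

/-- The constant in the estimate of a single Lindeberg step. -/
noncomputable def stepConst (d : ℕ) (B K : ℝ) : ℝ :=
  2 * gaussMeanNorm (Vec d) ^ 2 * ((2 * B) ^ 3 + (∫ z : Vec d, ‖z‖ ^ 3 ∂(stdGaussian (Vec d))) +
    d ^ 2 * K * (2 * gaussMeanNorm (Vec d) + 2 * B))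

/-- A single Lindeberg step: exchanging a unit of Gaussian noise for a martingale increment changes
the corrected expectation by `O(1 / s)` only. -/
theorem abs_step_le (hX : IsMarkovChain P μ X) (hv : ∀ x, ‖v x‖ ≤ B)
    (hg : LipschitzWith L g) (hs : 1 ≤ s) (hWb : ∀ a b x, |W a b x| ≤ K)
    (hW : ∀ a b x, W a b x - ∫ y, W a b y ∂(P x) =
      incrementCov P v a b x - if a = b then 1 else 0) (k : ℕ) :
    |(∫ ω, heat (s + 1) g (martSum P v X (k + 1) ω) ∂μ + correction μ P v X W g s (k + 1)) -
      (∫ ω, heat (s + 1 + 1) g (martSum P v X k ω) ∂μ + correction μ P v X W g (s + 1) k)| ≤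
      L * stepConst d B K / s := by
  set m : ℝ := ((gaussMeanNorm (Vec d) : ℝ≥0) : ℝ) with hm
  set M3 : ℝ := ∫ z : Vec d, ‖z‖ ^ 3 ∂(stdGaussian (Vec d)) with hM3
  have hs1 : 1 ≤ s + 1 := le_add_self
  have hs0 : (0 : ℝ) < s := by exact_mod_cast zero_lt_one.trans_le hs
  have hm0 : 0 ≤ m := NNReal.coe_nonneg _
  have hM30 : 0 ≤ M3 := integral_nonneg fun _ => by positivity
  have hB : 0 ≤ 2 * B := by
    obtain ⟨ω⟩ : Nonempty Ω := nonempty_of_isProbabilityMeasure μ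
    exact (norm_nonneg _).trans (norm_increment_le (P := P) hv (X 0 ω) (X 0 ω))
  set H : Fin d → Fin d → Vec d → ℝ := fun a b => heatHess (s + 1) (stdVec a) (stdVec b) g with hH
  have h1 : |∫ ω, heat (s + 1) g (martSum P v X (k + 1) ω) ∂μ -
      ∫ ω, heat (s + 1) g (martSum P v X k ω) ∂μ -
      (∑ a, ∑ b, ∫ ω, H a b (martSum P v X k ω) * incrementCov P v a b (X k ω) ∂μ) / 2| ≤
      L * (2 * m ^ 2) / s * (2 * B) ^ 3 :=
    (abs_integral_heat_martSum_succ_sub_le hX hv hg hs1 k).trans (by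
      gcongr
      exact le_self_add)
  have h2 : |∫ ω, heat (s + 1 + 1) g (martSum P v X k ω) ∂μ -
      ∫ ω, heat (s + 1) g (martSum P v X k ω) ∂μ -
      (∑ a, ∫ ω, H a a (martSum P v X k ω) ∂μ) / 2| ≤ L * (2 * m ^ 2) / s * M3 :=
    (abs_integral_heat_add_one_sub_le hX hv hg hs1 k).trans (by
      gcongr
      exact le_self_add)
  -- Poisson's equation for the conditional covariances
  have h3 : (∑ a, ∑ b, ∫ ω, H a b (martSum P v X k ω) * incrementCov P v a b (X k ω) ∂μ) -
      ∑ a, ∫ ω, H a a (martSum P v X k ω) ∂μ =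
      (∑ a, ∑ b, ∫ ω, H a b (martSum P v X k ω) * W a b (X k ω) ∂μ) -
      ∑ a, ∑ b, ∫ ω, H a b (martSum P v X k ω) * W a b (X (k + 1) ω) ∂μ := by
    rw [← Finset.sum_sub_distrib, ← Finset.sum_sub_distrib]
    refine Finset.sum_congr rfl fun a _ => ?_
    rw [← Finset.sum_sub_distrib, ← Finset.sum_congr rfl fun b _ =>
      integral_heatHess_mul_incrementCov hX hv hg hs1 hWb hW k a b (stdVec a) (stdVec b),
      Finset.sum_sub_distrib]
    simp [hH]
  -- changing the time and the position in the Hessian costs `O(1 / s)`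
  have h4 : ∀ a b, |∫ ω, heatHess s (stdVec a) (stdVec b) g (martSum P v X (k + 1) ω) *
      W a b (X (k + 1) ω) ∂μ - ∫ ω, H a b (martSum P v X k ω) * W a b (X (k + 1) ω) ∂μ| ≤
      L * (2 * m ^ 2) / s * (2 * m + 2 * B) * K := by
    intro a b
    rw [← integral_sub (integrable_heatHess_mul hX hg hs _ _ _ _ (hWb a b))
      (integrable_heatHess_mul hX hg hs1 _ _ _ _ (hWb a b))]
    have := norm_integral_le_of_norm_le_const (μ := μ)
      (f := fun ω => heatHess s (stdVec a) (stdVec b) g (martSum P v X (k + 1) ω) *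
      W a b (X (k + 1) ω) - H a b (martSum P v X k ω) * W a b (X (k + 1) ω))
      (C := L * (2 * m ^ 2) / s * (2 * m + 2 * B) * K) (ae_of_all _ fun ω => by
        rw [← sub_mul, norm_mul]
        refine mul_le_mul ?_ (hWb _ _ _) (norm_nonneg _) (by positivity)
        have e1 := abs_heatHess_add_one_sub_le hg (s := s) (by exact_mod_cast hs0.ne') (stdVec a)
          (stdVec b) (martSum P v X k ω)
        have e2 := abs_sub_le_of_lipschitzWith (lipschitzWith_heatHess (s := s) hg (stdVec a)
          (stdVec b)) (martSum P v X (k + 1) ω) (martSum P v X k ω)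
        have e3 : martSum P v X (k + 1) ω - martSum P v X k ω =
            increment P v (X k ω) (X (k + 1) ω) := by
          rw [martSum, Finset.sum_range_succ, martSum, add_sub_cancel_left]
        rw [e3] at e2
        have e4 := norm_increment_le (P := P) hv (X k ω) (X (k + 1) ω)
        push_cast at e2
        rw [norm_stdVec, norm_stdVec, mul_one, mul_one, ← hm] at e1 e2
        have e5 : |heatHess s (stdVec a) (stdVec b) g (martSum P v X (k + 1) ω) -
          heatHess s (stdVec a) (stdVec b) g (martSum P v X k ω)| ≤
          L * (2 * m ^ 2) / s * (2 * B) := e2.trans (by gcongr)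
        rw [abs_sub_comm] at e1
        refine (abs_sub_le _ (heatHess s (stdVec a) (stdVec b) g (martSum P v X k ω)) _).trans ?_
        calc _ ≤ L * (2 * m ^ 2) / s * (2 * B) + 2 * m * (L * (2 * m ^ 2) / s) := add_le_add e5 e1
          _ = _ := by ring)
    simpa using this
  have h5 : |(∑ a, ∑ b, ∫ ω, heatHess s (stdVec a) (stdVec b) g (martSum P v X (k + 1) ω) *
      W a b (X (k + 1) ω) ∂μ) - ∑ a, ∑ b, ∫ ω, H a b (martSum P v X k ω) *
      W a b (X (k + 1) ω) ∂μ| ≤ d ^ 2 * (L * (2 * m ^ 2) / s * (2 * m + 2 * B) * K) := by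
    rw [← Finset.sum_sub_distrib]
    calc _ ≤ ∑ a : Fin d, ∑ b : Fin d, L * (2 * m ^ 2) / s * (2 * m + 2 * B) * K :=
          (Finset.abs_sum_le_sum_abs _ _).trans (Finset.sum_le_sum fun a _ => by
            rw [← Finset.sum_sub_distrib]
            exact (Finset.abs_sum_le_sum_abs _ _).trans (Finset.sum_le_sum fun b _ => h4 a b))
      _ = _ := by
        simp only [Finset.sum_const, Finset.card_univ, Fintype.card_fin, nsmul_eq_mul]
        ring
  have hfin : L * stepConst d B K / s = L * (2 * m ^ 2) / s * (2 * B) ^ 3 +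
      L * (2 * m ^ 2) / s * M3 + d ^ 2 * (L * (2 * m ^ 2) / s * (2 * m + 2 * B) * K) := by
    rw [stepConst]
    ring
  rw [hfin]
  simp only [correction]
  rw [abs_le] at h1 h2 h5 ⊢
  simp only [hH] at h1 h2 h3 h5
  constructor <;> linarith [h1.1, h1.2, h2.1, h2.2, h5.1, h5.2, h3]

/-- Summing the Lindeberg steps. The time is counted down to `t + 1 ≥ 1`, which keeps the Hessian
bounded at the last step. -/
theorem abs_telescope_le (hX : IsMarkovChain P μ X) (hv : ∀ x, ‖v x‖ ≤ B)
    (hg : LipschitzWith L g) (hWb : ∀ a b x, |W a b x| ≤ K)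
    (hW : ∀ a b x, W a b x - ∫ y, W a b y ∂(P x) =
      incrementCov P v a b x - if a = b then 1 else 0) (k : ℕ) (t : ℕ) :
    |(∫ ω, heat ((t + 1 : ℕ) + 1) g (martSum P v X k ω) ∂μ +
        correction μ P v X W g (t + 1 : ℕ) k) -
      (∫ ω, heat ((t + 1 + k : ℕ) + 1) g (martSum P v X 0 ω) ∂μ +
        correction μ P v X W g (t + 1 + k : ℕ) 0)| ≤
      L * stepConst d B K * ∑ i ∈ Finset.range k, ((t + 1 + i : ℕ) : ℝ)⁻¹ := by
  induction k generalizing t with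
  | zero => simp
  | succ k ih =>
    have h1 := abs_step_le hX hv hg (s := ((t + 1 : ℕ) : ℝ≥0)) (by exact_mod_cast (by omega))
      hWb hW k
    have h2 := ih (t + 1)
    have e : t + 1 + 1 + k = t + 1 + (k + 1) := by ring
    rw [e] at h2
    have e2 : ((t + 1 : ℕ) : ℝ≥0) + 1 = ((t + 1 + 1 : ℕ) : ℝ≥0) := by push_cast; rfl
    rw [e2] at h1 ⊢
    have e3 : ∑ i ∈ Finset.range (k + 1), ((t + 1 + i : ℕ) : ℝ)⁻¹ =
        ∑ i ∈ Finset.range k, ((t + 1 + 1 + i : ℕ) : ℝ)⁻¹ + ((t + 1 : ℕ) : ℝ)⁻¹ := by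
      rw [Finset.sum_range_succ']
      congr 1
      exact Finset.sum_congr rfl fun i _ => by push_cast; ring_nf
    rw [e3, mul_add]
    refine (abs_sub_le _ _ _).trans ((add_le_add h1 h2).trans (le_of_eq ?_))
    rw [NNReal.coe_natCast]
    ring

/-- Gaussian approximation of the partial sums of the martingale increments, when these have
identity covariance in the stationary regime, with an error that grows logarithmically. -/
theorem exists_abs_integral_martSum_sub_le (hX : IsMarkovChain P μ X) {π : Measure S}
    [IsProbabilityMeasure π] (herg : IsUniformlyGeometricallyErgodic P π)
    (hv : ∀ x, ‖v x‖ ≤ B)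
    (hcov : ∀ a b, ∫ x, incrementCov P v a b x ∂π = if a = b then 1 else 0) :
    ∃ C : ℝ, 0 ≤ C ∧ ∀ (n : ℕ) (L : ℝ≥0) (g : Vec d → ℝ), LipschitzWith L g →
      |∫ ω, g (martSum P v X n ω) ∂μ - ∫ z, g (√n • z) ∂(stdGaussian (Vec d))| ≤
        L * (C * (1 + ∑ i ∈ Finset.range n, ((1 + i : ℕ) : ℝ)⁻¹)) := by
  obtain ⟨K, hK, hsol⟩ := exists_bounded_poisson_solution P π herg
  choose W hWb hW using fun a b => hsol (incrementCov P v a b) ((2 * B) ^ 2)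
    (abs_incrementCov_le hv a b)
  simp_rw [hcov] at hW
  set K' := K * (2 * B) ^ 2 with hK'
  have hK'0 : 0 ≤ K' := by positivity
  set m : ℝ := ((gaussMeanNorm (Vec d) : ℝ≥0) : ℝ) with hm
  have hm0 : 0 ≤ m := NNReal.coe_nonneg _
  have hB : 0 ≤ 2 * B := by
    obtain ⟨ω⟩ : Nonempty Ω := nonempty_of_isProbabilityMeasure μ
    exact (norm_nonneg _).trans (norm_increment_le (P := P) hv (X 0 ω) (X 0 ω))
  have hsc : 0 ≤ stepConst d B K' := by
    have : 0 ≤ ∫ z : Vec d, ‖z‖ ^ 3 ∂(stdGaussian (Vec d)) := integral_nonneg fun _ => by positivity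
    unfold stepConst
    positivity
  refine ⟨stepConst d B K' + 4 * m + 2 * (d ^ 2 * m * K'), by positivity, fun n L g hg => ?_⟩
  have hsq : NNReal.sqrt 2 ≤ 2 := by
    rw [NNReal.sqrt_le_iff_le_sq]
    norm_num
  have hsq' : (NNReal.sqrt 2 : ℝ) ≤ 2 := by exact_mod_cast hsq
  have ht := abs_telescope_le hX hv hg hWb hW n 0
  have h0 : ∀ ω, martSum P v X 0 ω = 0 := fun ω => by simp [martSum]
  simp only [h0, integral_const, probReal_univ, one_smul, zero_add] at ht
  have c1 := abs_correction_le (μ := μ) (P := P) (v := v) (X := X) hg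
    (s := ((1 : ℕ) : ℝ≥0)) (by simp) hWb n
  have c2 := abs_correction_le (μ := μ) (P := P) (v := v) (X := X) hg
    (s := ((1 + n : ℕ) : ℝ≥0)) (by simp) hWb 0
  have hend : |∫ ω, heat ((1 : ℕ) + 1) g (martSum P v X n ω) ∂μ -
      ∫ ω, g (martSum P v X n ω) ∂μ| ≤ L * (2 * m) := by
    rw [← integral_sub (integrable_lipschitz_martSum hX hv n (lipschitzWith_heat hg _))
      (integrable_lipschitz_martSum hX hv n hg)]
    have := norm_integral_le_of_norm_le_const (μ := μ) (C := L * (2 * m))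
      (f := fun ω => heat ((1 : ℕ) + 1) g (martSum P v X n ω) - g (martSum P v X n ω))
      (ae_of_all _ fun ω => by
        have e : (((1 : ℕ) : ℝ≥0) + 1) = 2 := by norm_num
        rw [heat, e]
        refine (abs_gaussSmooth_sub_le hg _ _).trans ?_
        rw [mul_assoc]
        gcongr)
    simpa using this
  have hstart : |heat ((1 + n : ℕ) + 1) g 0 - heat n g 0| ≤ L * (2 * m) := by
    have e : (((1 + n : ℕ) : ℝ≥0) + 1) = n + NNReal.sqrt 2 ^ 2 := by
      rw [NNReal.sq_sqrt]
      push_cast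
      ring
    rw [e, ← gaussSmooth_heat hg]
    refine (abs_gaussSmooth_sub_le (lipschitzWith_heat hg _) _ _).trans ?_
    rw [mul_assoc]
    gcongr
  have hgauss : heat n g 0 = ∫ z, g (√n • z) ∂(stdGaussian (Vec d)) := by
    simp [heat, gaussSmooth]
  rw [← hgauss]
  set H := ∑ i ∈ Finset.range n, ((1 + i : ℕ) : ℝ)⁻¹ with hH
  have hH0 : 0 ≤ H := Finset.sum_nonneg fun _ _ => by positivity
  have hrest : L * ((4 * m + 2 * (d ^ 2 * m * K')) * 1) ≤
      L * ((4 * m + 2 * (d ^ 2 * m * K')) * (1 + H)) := by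
    gcongr
    linarith
  have hrest2 : L * stepConst d B K' * H ≤ L * (stepConst d B K' * (1 + H)) := by
    rw [mul_assoc]
    gcongr
    linarith
  rw [abs_le] at ht c1 c2 hend hstart ⊢
  constructor <;> linarith [ht.1, ht.2, c1.1, c1.2, c2.1, c2.2, hend.1, hend.2, hstart.1, hstart.2]

end Lindeberg

/-! ### States reached by the chain -/

section Reachable

variable {S Ω : Type*} [Countable S] [MeasurableSpace S] [DiscreteMeasurableSpace S]
  [MeasurableSpace Ω] {μ : Measure Ω} [IsProbabilityMeasure μ] {P : Kernel S S} [IsMarkovKernel P]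
  {X : ℕ → Ω → S} {π : Measure S} [IsProbabilityMeasure π]

/-- The states that the chain visits with positive probability. -/
def reachable (μ : Measure Ω) (X : ℕ → Ω → S) : Set S :=
  {y | ∃ k, μ {ω | X k ω = y} ≠ 0}

omit [MeasurableSpace S] [DiscreteMeasurableSpace S] [IsProbabilityMeasure μ] in
theorem ae_mem_reachable (k : ℕ) : ∀ᵐ ω ∂μ, X k ω ∈ reachable μ X := by
  have h : ∀ y, ∀ᵐ ω ∂μ, X k ω = y → y ∈ reachable μ X := by
    intro y
    by_cases hy : y ∈ reachable μ X
    · exact ae_of_all _ fun _ _ => hy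
    · have : μ {ω | X k ω = y} = 0 := by
        by_contra h0
        exact hy ⟨k, h0⟩
      filter_upwards [measure_eq_zero_iff_ae_notMem.1 this] with ω h1 h2
      exact absurd h2 h1
  filter_upwards [ae_all_iff.2 h] with ω hω
  exact hω _ rfl

/-- The chain cannot leave the set of reachable states. -/
theorem ae_transition_mem_reachable (hX : IsMarkovChain P μ X) {x : S}
    (hx : x ∈ reachable μ X) : ∀ᵐ y ∂(P x), y ∈ reachable μ X := by
  classical
  obtain ⟨k, hk⟩ := hx
  have h := integral_next_eq hX k (Y := history X k) (F := id) (fun _ => rfl)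
    (f := fun _ x' y => (if x' = x then 1 else 0) * (if y ∈ reachable μ X then 0 else 1))
    (C := 1) (fun _ _ _ => by split_ifs <;> simp)
  have h0 : ∫ ω, ((if X k ω = x then 1 else 0) *
      (if X (k + 1) ω ∈ reachable μ X then 0 else 1) : ℝ) ∂μ = 0 := by
    rw [integral_eq_zero_of_ae]
    filter_upwards [ae_mem_reachable (μ := μ) (X := X) (k + 1)] with ω hω
    simp [hω]
  have h1 : ∀ ω, ∫ y, ((if X k ω = x then 1 else 0) *
      (if y ∈ reachable μ X then 0 else 1) : ℝ) ∂(P (X k ω)) =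
      ({ω | X k ω = x}.indicator (fun _ => (P x).real (reachable μ X)ᶜ)) ω := by
    intro ω
    have h2 : (fun y => (if y ∈ reachable μ X then 0 else 1 : ℝ)) =
        (reachable μ X)ᶜ.indicator 1 := by
      ext y
      by_cases hy : y ∈ reachable μ X <;> simp [hy]
    by_cases hω : X k ω = x
    · simp only [hω, if_true, one_mul, h2]
      rw [integral_indicator_one (.of_discrete)]
      simp [hω]
    · simp [hω]
  simp_rw [h0, h1] at h
  have hmeas : MeasurableSet {ω | X k ω = x} := hX.measurable k (.singleton x)
  rw [integral_indicator hmeas, setIntegral_const, eq_comm,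
    smul_eq_mul, mul_eq_zero] at h
  rcases h with h | h
  · exact absurd ((measureReal_eq_zero_iff).1 h) hk
  · rw [measureReal_eq_zero_iff] at h
    exact h

/-- By convergence to equilibrium, the stationary distribution is carried by the reachable
states. -/
theorem ae_stationary_mem_reachable (hX : IsMarkovChain P μ X)
    (herg : IsUniformlyGeometricallyErgodic P π) : ∀ᵐ y ∂π, y ∈ reachable μ X := by
  classical
  obtain ⟨ω, hω⟩ := (ae_mem_reachable (μ := μ) (X := X) 0).exists
  set R := reachable μ X with hR
  have hpow : ∀ n, ∀ᵐ y ∂((P ^ n) (X 0 ω)), y ∈ R := by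
    intro n
    induction n with
    | zero =>
      have : (P ^ 0) (X 0 ω) = Measure.dirac (X 0 ω) := by
        change Kernel.id (X 0 ω) = _
        rw [Kernel.id_apply]
      rw [this, ae_dirac_eq]
      exact hω
    | succ n ih =>
      change ((P ^ (n + 1)) (X 0 ω)) Rᶜ = 0
      rw [Kernel.pow_succ_apply_eq_lintegral _ _ _ (.of_discrete), lintegral_eq_zero_iff
        Measurable.of_discrete]
      filter_upwards [ih] with y hy
      exact ae_transition_mem_reachable hX hy
  obtain ⟨K, hK, ρ, hρ0, hρ1, h⟩ := herg
  have hle : ∀ n : ℕ, π.real Rᶜ ≤ 2 * 1 * (K * ρ ^ n) := by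
    intro n
    have h1 := abs_integral_sub_integral_le ((P ^ n) (X 0 ω)) π
      (f := Rᶜ.indicator 1) (B := 1) (fun x => by
        by_cases hx : x ∈ Rᶜ
        · simp [Set.indicator_of_mem hx]
        · simp [Set.indicator_of_notMem hx])
    rw [integral_indicator_one .of_discrete, integral_indicator_one .of_discrete] at h1
    have h2 : ((P ^ n) (X 0 ω)).real Rᶜ = 0 := by
      rw [measureReal_eq_zero_iff]
      exact hpow n
    rw [h2, zero_sub, abs_neg, abs_of_nonneg measureReal_nonneg] at h1
    refine h1.trans ?_
    gcongr
    exact h _ _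
  have hlim : Tendsto (fun n : ℕ => 2 * 1 * (K * ρ ^ n)) atTop (𝓝 (2 * 1 * (K * 0))) :=
    ((tendsto_pow_atTop_nhds_zero_of_lt_one hρ0 hρ1).const_mul K).const_mul _
  have h0 : π.real Rᶜ = 0 :=
    le_antisymm ((ge_of_tendsto' hlim hle).trans (by simp)) measureReal_nonneg
  exact (measureReal_eq_zero_iff).1 h0

end Reachable

/-! ### Whitening the increments -/

section Whitening

variable {S Ω : Type*} [Countable S] [MeasurableSpace S] [DiscreteMeasurableSpace S]
  [MeasurableSpace Ω] {μ : Measure Ω} [IsProbabilityMeasure μ] {P : Kernel S S} [IsMarkovKernel P]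
  {X : ℕ → Ω → S} {d : ℕ} {V : S → Vec d} {B : ℝ}

omit [Countable S] in
theorem increment_clm (hV : ∀ x, ‖V x‖ ≤ B) (A : Vec d →L[ℝ] Vec d) (x y : S) :
    increment P (fun z => A (V z)) x y = A (increment P V x y) := by
  rw [increment, transitionMean, A.integral_comp_comm (integrable_of_norm_le _ hV), ← map_sub]
  rfl

omit [Countable S] [MeasurableSpace Ω] in
theorem martSum_clm (hV : ∀ x, ‖V x‖ ≤ B) (A : Vec d →L[ℝ] Vec d) (n : ℕ) (ω : Ω) :
    martSum P (fun z => A (V z)) X n ω = A (martSum P V X n ω) := by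
  simp only [martSum, increment_clm hV, map_sum]

omit [Countable S] in
theorem incrementCov_toEuclideanCLM (hV : ∀ x, ‖V x‖ ≤ B) (Q : Matrix (Fin d) (Fin d) ℝ)
    (a b : Fin d) (x : S) :
    incrementCov P (fun z => Matrix.toEuclideanCLM (n := Fin d) (𝕜 := ℝ) Q (V z)) a b x =
      ∑ c, ∑ e, Q a c * Q b e * incrementCov P V c e x := by
  have hi : ∀ c e, Integrable (fun y => Q a c * Q b e *
      (increment P V x y c * increment P V x y e)) (P x) := fun c e =>
    (integrable_of_abs_le _ fun y => abs_increment_mul_le hV x y c e).const_mul _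
  simp only [incrementCov, ← integral_const_mul]
  simp_rw [← integral_finsetSum _ fun e _ => hi _ e]
  rw [← integral_finsetSum _ fun c _ => integrable_finsetSum _ fun e _ => hi c e]
  refine integral_congr_ae (ae_of_all _ fun y => ?_)
  simp only [increment_clm hV, Matrix.ofLp_toEuclideanCLM, Matrix.mulVec, dotProduct]
  rw [Finset.sum_mul_sum]
  exact Finset.sum_congr rfl fun c _ => Finset.sum_congr rfl fun e _ => by ring

/-- The asymptotic covariance is the stationary mean of the conditional covariances, also after
`V` has been changed to a bounded function `V'` outside a set `R` that carries `π` and that the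
chain does not leave. -/
theorem integral_incrementCov_eq_asympCov {π : Measure S} [IsProbabilityMeasure π]
    {V V' : S → Vec d} {R : Set S} (hV' : ∀ x, ‖V' x‖ ≤ B) (hRV : ∀ x ∈ R, V' x = V x)
    (hP : ∀ x ∈ R, ∀ᵐ y ∂(P x), y ∈ R) (hπ : ∀ᵐ x ∂π, x ∈ R) (a b : Fin d) :
    ∫ x, incrementCov P V' a b x ∂π = asympCov P π V a b := by
  rw [integral_countable (integrable_of_abs_le π (abs_incrementCov_le hV' a b)), asympCov,
    Matrix.of_apply]
  refine tsum_congr fun i => ?_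
  by_cases hi : i ∈ R
  · have hmean : transitionMean P V i = transitionMean P V' i := by
      refine integral_congr_ae ?_
      filter_upwards [hP i hi] with y hy
      rw [hRV y hy]
    rw [incrementCov, integral_countable
      (integrable_of_abs_le _ fun y => abs_increment_mul_le hV' i y a b), smul_eq_mul,
      ← tsum_mul_left]
    refine tsum_congr fun j => ?_
    by_cases hj : j ∈ R
    · rw [increment, hmean, hRV j hj, smul_eq_mul]
      simp only [PiLp.sub_apply]
      ring
    · have : (P i).real {j} = 0 := by
        rw [measureReal_eq_zero_iff]
        exact measure_mono_null (by simpa using hj) (hP i hi)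
      simp [this]
  · have : π.real {i} = 0 := by
      rw [measureReal_eq_zero_iff]
      exact measure_mono_null (by simpa using hi) hπ
    simp [this]

theorem sqrt_mul_sqrt_of_posDef {Q : Matrix (Fin d) (Fin d) ℝ} (hQ : Q.PosDef) :
    CFC.sqrt Q * CFC.sqrt Q = Q :=
  CFC.sqrt_mul_sqrt_self Q (Matrix.nonneg_iff_posSemidef.2 hQ.posSemidef)

theorem isUnit_det_sqrt_of_posDef {Q : Matrix (Fin d) (Fin d) ℝ} (hQ : Q.PosDef) :
    IsUnit (CFC.sqrt Q).det := by
  have h := (Matrix.isUnit_iff_isUnit_det _).1 hQ.isUnit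
  rw [← sqrt_mul_sqrt_of_posDef hQ, Matrix.det_mul] at h
  exact isUnit_of_mul_isUnit_left h

theorem transpose_sqrt (Q : Matrix (Fin d) (Fin d) ℝ) : (CFC.sqrt Q).transpose = CFC.sqrt Q := by
  have h := (Matrix.nonneg_iff_posSemidef.1 (CFC.sqrt_nonneg Q)).isHermitian.eq
  rwa [Matrix.conjTranspose_eq_transpose_of_trivial] at h

theorem inv_sqrt_whitens {Q : Matrix (Fin d) (Fin d) ℝ} (hQ : Q.PosDef) (a b : Fin d) :
    ∑ c, ∑ e, (CFC.sqrt Q)⁻¹ a c * (CFC.sqrt Q)⁻¹ b e * Q c e = if a = b then 1 else 0 := by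
  have h1 : (CFC.sqrt Q)⁻¹ * Q * ((CFC.sqrt Q)⁻¹).transpose = 1 := by
    have hu := isUnit_det_sqrt_of_posDef hQ
    rw [Matrix.transpose_nonsing_inv, transpose_sqrt]
    nth_rewrite 2 [← sqrt_mul_sqrt_of_posDef hQ]
    rw [Matrix.nonsing_inv_mul_cancel_left _ _ hu, Matrix.mul_nonsing_inv _ hu]
  have h2 := congrFun (congrFun h1 a) b
  rw [Matrix.one_apply] at h2
  rw [← h2, Matrix.mul_apply]
  simp_rw [Matrix.mul_apply, Matrix.transpose_apply, Finset.sum_mul]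
  rw [Finset.sum_comm]
  exact Finset.sum_congr rfl fun c _ => Finset.sum_congr rfl fun e _ => by ring

end Whitening

theorem one_add_sum_inv_le_rpow {ε : ℝ} (hε : 0 < ε) {n : ℕ} (hn : 1 ≤ n) :
    1 + ∑ i ∈ Finset.range n, ((1 + i : ℕ) : ℝ)⁻¹ ≤ (2 + 1 / ε) * (n : ℝ) ^ ε := by
  have h1 := harmonic_le_one_add_log n
  have h2 : ((harmonic n : ℚ) : ℝ) = ∑ i ∈ Finset.range n, ((1 + i : ℕ) : ℝ)⁻¹ := by
    rw [harmonic]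
    push_cast
    exact Finset.sum_congr rfl fun i _ => by rw [add_comm]
  have h3 := Real.log_le_rpow_div (Nat.cast_nonneg n) hε
  have h4 : (1 : ℝ) ≤ (n : ℝ) ^ ε := Real.one_le_rpow (by exact_mod_cast hn) hε.le
  rw [h2] at h1
  calc _ ≤ 2 + (n : ℝ) ^ ε / ε := by linarith
    _ ≤ 2 * (n : ℝ) ^ ε + (n : ℝ) ^ ε / ε := by linarith
    _ = _ := by ring

theorem inv_sqrt_mul_rpow {β : ℝ} {n : ℕ} (hn : 1 ≤ n) :
    (√n)⁻¹ * (n : ℝ) ^ ((1 - β) / 2) = (n : ℝ) ^ (-(β / 2)) := by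
  have hn0 : (0 : ℝ) < n := by exact_mod_cast hn
  rw [Real.sqrt_eq_rpow, ← Real.rpow_neg hn0.le, ← Real.rpow_add hn0]
  congr 1
  ring

/-! ### From the martingale to the scaled sums -/

section Assembly

variable {S Ω : Type*} [Countable S] [MeasurableSpace S] [DiscreteMeasurableSpace S]
  [MeasurableSpace Ω] {μ : Measure Ω} [IsProbabilityMeasure μ] {P : Kernel S S} [IsMarkovKernel P]
  {X : ℕ → Ω → S} {π : Measure S} [IsProbabilityMeasure π] {d : ℕ} {r V V' : S → Vec d} {B : ℝ}

omit [IsProbabilityMeasure π] in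
/-- Poisson's equation writes the sum of the rewards as a martingale plus boundary terms. -/
theorem ae_scaledSum_eq (hX : IsMarkovChain P μ X) (hV : IsPoissonSolution P π r V)
    (hRV : ∀ x ∈ reachable μ X, V' x = V x) (n : ℕ) :
    ∀ᵐ ω ∂μ, scaledSum π r X n ω =
      (√n)⁻¹ • (V' (X 0 ω) - V' (X n ω) + martSum P V' X n ω) := by
  filter_upwards [ae_all_iff.2 fun k => ae_mem_reachable (μ := μ) (X := X) k] with ω hω
  have hr : ∀ k, r (X k ω) - statMean π r =
      (V' (X k ω) - V' (X (k + 1) ω)) + increment P V' (X k ω) (X (k + 1) ω) := by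
    intro k
    have hmean : transitionMean P V' (X k ω) = transitionMean P V (X k ω) := by
      refine integral_congr_ae ?_
      filter_upwards [ae_transition_mem_reachable hX (hω k)] with y hy
      rw [hRV y hy]
    rw [hV.equation (X k ω), increment, hmean, hRV _ (hω k)]
    abel
  have hsum : ∑ k ∈ Finset.Icc 1 n, (r (X (k - 1) ω) - statMean π r) =
      ∑ k ∈ Finset.range n, (r (X k ω) - statMean π r) := by
    rw [← Finset.Ico_add_one_right_eq_Icc, Finset.sum_Ico_eq_sum_range]
    simp
  rw [scaledSum, hsum]
  simp_rw [hr]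
  rw [Finset.sum_add_distrib, Finset.sum_range_sub' (fun k => V' (X k ω)), martSum]

omit [Countable S] [IsProbabilityMeasure μ] [IsMarkovKernel P] [IsProbabilityMeasure π] in
theorem measurable_scaledSum (hX : IsMarkovChain P μ X) (n : ℕ) :
    Measurable (scaledSum π r X n) :=
  Measurable.const_smul (Finset.measurable_sum (Finset.Icc 1 n) fun k _ => (Measurable.of_discrete
    (f := fun x => r x - statMean π r)).comp (hX.measurable (k - 1))) (√n)⁻¹

omit [IsProbabilityMeasure π] in
theorem integrable_scaledSum (hX : IsMarkovChain P μ X) (hV : IsPoissonSolution P π r V)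
    (hRV : ∀ x ∈ reachable μ X, V' x = V x) (hV' : ∀ x, ‖V' x‖ ≤ B) (n : ℕ) :
    Integrable (scaledSum π r X n) μ := by
  refine Integrable.of_bound (measurable_scaledSum hX n).aestronglyMeasurable
    ((√n)⁻¹ * (B + B + n * (2 * B))) ?_
  filter_upwards [ae_scaledSum_eq hX hV hRV n] with ω hω
  rw [hω, norm_smul, Real.norm_of_nonneg (by positivity)]
  gcongr
  refine (norm_add_le _ _).trans (add_le_add ((norm_sub_le _ _).trans ?_)
    (norm_martSum_le hV' n ω))
  exact add_le_add (hV' _) (hV' _)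

theorem integrable_lipschitz_comp {E : Type*} [NormedAddCommGroup E] [MeasurableSpace E]
    [BorelSpace E] [SecondCountableTopology E] {h : E → ℝ} (hh : LipschitzWith 1 h) {U : Ω → E}
    (hU : Integrable U μ) : Integrable (fun ω => h (U ω)) μ := by
  refine ((integrable_const |h 0|).add hU.norm).mono'
    (hh.continuous.comp_aestronglyMeasurable hU.1) (ae_of_all _ fun ω => ?_)
  simpa using abs_add_le_of_lipschitzWith hh 0 (U ω)

/-- Quantitative normal approximation of the scaled sums for a single Lipschitz test function. -/
theorem exists_integral_scaledSum_sub_le (hX : IsMarkovChain P μ X)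
    (herg : IsUniformlyGeometricallyErgodic P π) (hV : IsPoissonSolution P π r V)
    (hpos : (asympCov P π V).PosDef)
    (hRV : ∀ x ∈ reachable μ X, V' x = V x) (hV' : ∀ x, ‖V' x‖ ≤ B) :
    ∃ C : ℝ, 0 ≤ C ∧ ∀ n : ℕ, 1 ≤ n → ∀ h : Vec d → ℝ, LipschitzWith 1 h →
      ∫ ω, h (scaledSum π r X n ω) ∂μ - ∫ z, h (Matrix.toEuclideanCLM (n := Fin d) (𝕜 := ℝ)
        (CFC.sqrt (asympCov P π V)) z) ∂(stdGaussian (Vec d)) ≤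
      (√n)⁻¹ * (C * (1 + ∑ i ∈ Finset.range n, ((1 + i : ℕ) : ℝ)⁻¹)) := by
  set Q := asympCov P π V with hQ
  set T : Vec d →L[ℝ] Vec d := Matrix.toEuclideanCLM (n := Fin d) (𝕜 := ℝ) (CFC.sqrt Q) with hT
  set T' : Vec d →L[ℝ] Vec d := Matrix.toEuclideanCLM (n := Fin d) (𝕜 := ℝ) (CFC.sqrt Q)⁻¹
    with hT'
  have hTT' : ∀ w, T (T' w) = w := fun w => by
    rw [← mul_apply_eq_comp, hT, hT', ← map_mul,
      Matrix.mul_nonsing_inv _ (isUnit_det_sqrt_of_posDef hpos), map_one,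
      one_apply_eq_self]
  have hB : 0 ≤ B := by
    obtain ⟨ω⟩ : Nonempty Ω := nonempty_of_isProbabilityMeasure μ
    exact (norm_nonneg _).trans (hV' (X 0 ω))
  have hv : ∀ x, ‖T' (V' x)‖ ≤ ‖T'‖ * B := fun x => T'.le_opNorm_of_le (hV' x)
  have hcov : ∀ a b, ∫ x, incrementCov P (fun z => T' (V' z)) a b x ∂π =
      if a = b then 1 else 0 := by
    intro a b
    have hi : ∀ c e, Integrable (fun x => (CFC.sqrt Q)⁻¹ a c * (CFC.sqrt Q)⁻¹ b e *
        incrementCov P V' c e x) π := fun c e =>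
      (integrable_of_abs_le _ (abs_incrementCov_le hV' c e)).const_mul _
    simp_rw [hT', incrementCov_toEuclideanCLM hV']
    rw [integral_finsetSum _ fun c _ => integrable_finsetSum _ fun e _ => hi c e]
    simp_rw [integral_finsetSum _ fun e _ => hi _ e, integral_const_mul,
      integral_incrementCov_eq_asympCov hV' hRV
        (fun x hx => ae_transition_mem_reachable hX hx) (ae_stationary_mem_reachable hX herg)]
    exact inv_sqrt_whitens hpos a b
  obtain ⟨C, hC, hbound⟩ := exists_abs_integral_martSum_sub_le hX herg hv hcov
  refine ⟨2 * B + ‖T‖ * C, by positivity, fun n hn h hh => ?_⟩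
  have hn0 : (0 : ℝ) < √n := Real.sqrt_pos.2 (by exact_mod_cast hn)
  -- undo the whitening and the scaling inside the test function
  set g : Vec d → ℝ := fun z => h ((√n)⁻¹ • T z) with hg
  have hgL : LipschitzWith (Real.toNNReal ((√n)⁻¹) * ‖T‖₊) g := by
    refine LipschitzWith.of_dist_le_mul fun x y => ?_
    refine (hh.dist_le_mul _ _).trans ?_
    rw [NNReal.coe_one, one_mul, dist_eq_norm, dist_eq_norm, ← smul_sub, ← map_sub, norm_smul,
      NNReal.coe_mul, Real.coe_toNNReal _ (by positivity), coe_nnnorm, mul_assoc,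
      Real.norm_of_nonneg (by positivity)]
    gcongr
    exact T.le_opNorm _
  have hmain := hbound n _ g hgL
  have hgauss : ∫ z, g (√n • z) ∂(stdGaussian (Vec d)) = ∫ z, h (T z) ∂(stdGaussian (Vec d)) := by
    simp only [hg, map_smul, smul_smul, inv_mul_cancel₀ hn0.ne', one_smul]
  rw [hgauss, NNReal.coe_mul, Real.coe_toNNReal _ (by positivity), coe_nnnorm] at hmain
  have i1 := integrable_lipschitz_comp hh (integrable_scaledSum hX hV hRV hV' n)
  have i2 := integrable_lipschitz_martSum hX hv n hgL
  have hclose : |∫ ω, h (scaledSum π r X n ω) ∂μ -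
      ∫ ω, g (martSum P (fun z => T' (V' z)) X n ω) ∂μ| ≤ (√n)⁻¹ * (2 * B) := by
    rw [← integral_sub i1 i2]
    have := norm_integral_le_of_norm_le_const (μ := μ) (C := (√n)⁻¹ * (2 * B))
      (f := fun ω => h (scaledSum π r X n ω) - g (martSum P (fun z => T' (V' z)) X n ω)) (by
        filter_upwards [ae_scaledSum_eq hX hV hRV n] with ω hω
        refine (abs_sub_le_of_lipschitzWith hh _ _).trans ?_
        rw [hω, martSum_clm hV', hTT', ← smul_sub, add_sub_cancel_right, norm_smul,
          Real.norm_of_nonneg (by positivity), NNReal.coe_one, one_mul]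
        gcongr
        exact (norm_sub_le _ _).trans (by linarith [hV' (X 0 ω), hV' (X n ω)]))
    simpa using this
  set H := ∑ i ∈ Finset.range n, ((1 + i : ℕ) : ℝ)⁻¹ with hH
  have hH0 : 0 ≤ H := Finset.sum_nonneg fun _ _ => by positivity
  have hle : (√n)⁻¹ * (2 * B * 1) ≤ (√n)⁻¹ * (2 * B * (1 + H)) := by
    gcongr
    linarith
  have h1 := (abs_le.1 hclose).2
  have h2 := (abs_le.1 hmain).2
  linarith

end Assembly

end MarkovCLT

theorem theorem2 {S Ω Ω' : Type*}
    [Countable S] [MeasurableSpace S] [DiscreteMeasurableSpace S]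
    [MeasurableSpace Ω] (μ : Measure Ω) [IsProbabilityMeasure μ]
    [MeasurableSpace Ω'] (ν : Measure Ω') [IsProbabilityMeasure ν]
    {d : ℕ}
    -- the Markov chain
    (P : Kernel S S) [IsMarkovKernel P] (X : ℕ → Ω → S)
    (hX : MarkovCLT.IsMarkovChain P μ X)
    -- unique stationary distribution and uniform geometric ergodicity
    (π : Measure S) (hπ : MarkovCLT.IsUniqueStationary P π)
    (herg : MarkovCLT.IsUniformlyGeometricallyErgodic P π)
    -- a solution of Poisson's equation, bounded along the chain
    (r V : S → MarkovCLT.Vec d) (hV : MarkovCLT.IsPoissonSolution P π r V)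
    (M : ℝ) (hM : ∀ k, ∀ᵐ ω ∂μ, ‖V (X k ω)‖ ≤ M)
    -- the covariance condition on the martingale differences
    (hcov : MarkovCLT.CovarianceCondition P π V μ X)
    -- a standard Gaussian vector
    (Z : Ω' → MarkovCLT.Vec d) (hZ : HasLaw Z (stdGaussian (MarkovCLT.Vec d)) ν)
    (β : ℝ) (hβ : β ∈ Set.Ioo (0 : ℝ) 1) :
    (∀ n : ℕ, Integrable (MarkovCLT.scaledSum π r X n) μ) ∧
    ∃ C : ℝ, ∀ n : ℕ, 1 ≤ n →
      MarkovCLT.wassersteinDist μ (MarkovCLT.scaledSum π r X n) ν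
          (fun ω => Matrix.toEuclideanCLM (n := Fin d) (𝕜 := ℝ)
            (CFC.sqrt (MarkovCLT.asympCov P π V)) (Z ω))
        ≤ ENNReal.ofReal (C * (n : ℝ) ^ (-(β / 2))) := by
  classical
  have hπp : IsProbabilityMeasure π := hπ.1.1
  set R := MarkovCLT.reachable μ X with hR
  have hVR : ∀ x ∈ R, ‖V x‖ ≤ |M| := by
    rintro x ⟨k, hk⟩
    obtain ⟨ω, hω, hx⟩ := ((hM k).and_frequently (frequently_ae_iff.2 hk)).exists
    rw [← hx]
    exact hω.trans (le_abs_self M)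
  -- off the reachable states `V` may be unbounded; the chain does not see the value chosen there
  set V' : S → MarkovCLT.Vec d := fun x => if x ∈ R then V x else 0 with hV'
  have hRV : ∀ x ∈ R, V' x = V x := fun x hx => if_pos hx
  have hbd : ∀ x, ‖V' x‖ ≤ |M| := fun x => by
    by_cases hx : x ∈ R
    · rw [hRV x hx]
      exact hVR x hx
    · simp [hV', hx]
  refine ⟨MarkovCLT.integrable_scaledSum hX hV hRV hbd, ?_⟩
  obtain ⟨C, hC, hbound⟩ :=
    MarkovCLT.exists_integral_scaledSum_sub_le hX herg hV hcov.posDef hRV hbd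
  have hε : 0 < (1 - β) / 2 := by linarith [hβ.2]
  refine ⟨C * (2 + 1 / ((1 - β) / 2)), fun n hn => iSup₂_le fun h hh =>
    ENNReal.ofReal_le_ofReal ?_⟩
  have hlaw := hZ.integral_comp (f := fun z => h (Matrix.toEuclideanCLM (n := Fin d) (𝕜 := ℝ)
    (CFC.sqrt (MarkovCLT.asympCov P π V)) z))
    (hh.continuous.comp (ContinuousLinearMap.continuous _)).aestronglyMeasurable
  simp only [Function.comp_def] at hlaw
  rw [hlaw]
  refine (hbound n hn h hh).trans ?_
  calc _ ≤ (√n)⁻¹ * (C * ((2 + 1 / ((1 - β) / 2)) * (n : ℝ) ^ ((1 - β) / 2))) := by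
        gcongr
        exact MarkovCLT.one_add_sum_inv_le_rpow hε hn
    _ = _ := by
        rw [← MarkovCLT.inv_sqrt_mul_rpow hn]
        ring
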